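/- Let $F_n$ be the free group with basis $a_1,\dots,a_n$. For $n\ge 4$ embed $\mathrm{Aut}(F_2)$ in $\mathrm{Aut}(F_n)$ by extending each automorphism of $F_2=\langle a_1,a_2\rangle$ by $a_i\mapsto a_i$ for $3\le i\le n$. For a subgroup $H$ of a group $G$ and an integer $m \ge 0$, the pair $(G,H)$ has the relative property $\mathcal{FA}_m$ if, whenever $G$ acts by isometries on a nonempty complete $\mathrm{CAT}(0)$ space $X$ of (Lebesgue covering) dimension $m$, there is a point of $X$ fixed by every element of $H$. Theorem. For every $n\ge 4$, the pair $(\mathrm{Aut}(F_n),\mathrm{Aut}(F_2))$ has the relative property $\mathcal{FA}_{n-3}$. More generally, whenever $\mathrm{Aut}(F_n)$ acts by isometries (not necessarily semisimple) on a nonempty complete $\mathrm{CAT}(0)$ space $X$ of covering dimension $d<n-2$, there is a point of $X$ fixed by every element of $\mathrm{Aut}(F_2)$. -/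

import Mathlib

universe u v

/-- `γ`, restricted to `[0, 1]`, is a geodesic from `x` to `y`, parametrized proportionally to
arc length. -/
def IsGeodesic {X : Type*} [MetricSpace X] (γ : ℝ → X) (x y : X) : Prop :=
  γ 0 = x ∧ γ 1 = y ∧
    ∀ s ∈ Set.Icc (0 : ℝ) 1, ∀ t ∈ Set.Icc (0 : ℝ) 1, dist (γ s) (γ t) = |s - t| * dist x y

/-- A `CAT(0)` space: a geodesic metric space in which every geodesic triangle
(vertices `v 0, v 1, v 2`, sides `γ i` from `v i` to `v (i + 1)`, indices modulo `3`) is at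
least as thin as every triangle `w 0, w 1, w 2` in the Euclidean plane with the same side lengths.
The comparison map sends the point `γ i s` of a side to the point of the segment
`[w i, w (i + 1)]` with the same parameter `s`. -/
structure IsCAT0 (X : Type*) [MetricSpace X] : Prop where
  exists_geodesic : ∀ x y : X, ∃ γ : ℝ → X, IsGeodesic γ x y
  comparison : ∀ (v : Fin 3 → X) (γ : Fin 3 → ℝ → X) (w : Fin 3 → EuclideanSpace ℝ (Fin 2)),
    (∀ i, IsGeodesic (γ i) (v i) (v (i + 1))) →
    (∀ i, dist (w i) (w (i + 1)) = dist (v i) (v (i + 1))) →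
    ∀ i j, ∀ s ∈ Set.Icc (0 : ℝ) 1, ∀ t ∈ Set.Icc (0 : ℝ) 1,
      dist (γ i s) (γ j t) ≤
        dist (AffineMap.lineMap (w i) (w (i + 1)) s : EuclideanSpace ℝ (Fin 2))
          (AffineMap.lineMap (w j) (w (j + 1)) t)

/-- Lebesgue covering dimension at most `d`: every finite open cover has a finite open
refinement such that each point lies in at most `d + 1` of its members. -/
def CoveringDimLE (X : Type*) [TopologicalSpace X] (d : ℕ) : Prop :=
  ∀ U : Set (Set X), U.Finite → (∀ u ∈ U, IsOpen u) → ⋃₀ U = Set.univ →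
    ∃ V : Set (Set X), V.Finite ∧ (∀ v ∈ V, IsOpen v) ∧ ⋃₀ V = Set.univ ∧
      (∀ v ∈ V, ∃ u ∈ U, v ⊆ u) ∧ ∀ x : X, {v ∈ V | x ∈ v}.encard ≤ d + 1

/-- The Lebesgue covering dimension of a nonempty space, `⊤` if it is infinite. (The empty space,
whose dimension is `-1` by convention, also gets the value `0` here.) -/
noncomputable def coveringDim (X : Type*) [TopologicalSpace X] : ℕ∞ :=
  sInf {e : ℕ∞ | ∃ d : ℕ, e = d ∧ CoveringDimLE X d}

/-- The pair `(G, H)` has the relative property `FA_n`: whenever `G` acts by isometries on a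
(nonempty) complete `CAT(0)` space `X` of dimension `n`, the subgroup `H` has a fixed point. -/
def RelativeFA (G : Type v) [Group G] (H : Subgroup G) (n : ℕ) : Prop :=
  ∀ (X : Type u) [MetricSpace X] [CompleteSpace X] [Nonempty X] [MulAction G X]
    [IsIsometricSMul G X],
    IsCAT0 X → coveringDim X = n → ∃ x : X, ∀ h ∈ H, h • x = x

/-- The endomorphism of the free group on `a_1, …, a_n` extending the endomorphism `φ` of the
free group on `a_1, …, a_k` (for `k ≤ n`) and fixing `a_{k+1}, …, a_n`. -/
def freeGroupExtend {k n : ℕ} (hk : k ≤ n) (φ : FreeGroup (Fin k) →* FreeGroup (Fin k)) :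
    FreeGroup (Fin n) →* FreeGroup (Fin n) :=
  FreeGroup.lift fun i : Fin n =>
    if h : (i : ℕ) < k then FreeGroup.map (Fin.castLE hk) (φ (FreeGroup.of ⟨i, h⟩))
    else FreeGroup.of i

theorem freeGroupExtend_id {k n : ℕ} (hk : k ≤ n) :
    freeGroupExtend hk (MonoidHom.id _) = MonoidHom.id _ := by
  ext i
  by_cases h : (i : ℕ) < k <;> simp [freeGroupExtend, h]

theorem freeGroupExtend_map {k n : ℕ} (hk : k ≤ n)
    (φ : FreeGroup (Fin k) →* FreeGroup (Fin k)) (w : FreeGroup (Fin k)) :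
    freeGroupExtend hk φ (FreeGroup.map (Fin.castLE hk) w) =
      FreeGroup.map (Fin.castLE hk) (φ w) := by
  have : (freeGroupExtend hk φ).comp (FreeGroup.map (Fin.castLE hk)) =
      (FreeGroup.map (Fin.castLE hk)).comp φ := by
    ext i
    simp [freeGroupExtend]
  exact DFunLike.congr_fun this w

theorem freeGroupExtend_comp {k n : ℕ} (hk : k ≤ n)
    (φ ψ : FreeGroup (Fin k) →* FreeGroup (Fin k)) :
    freeGroupExtend hk (φ.comp ψ) = (freeGroupExtend hk φ).comp (freeGroupExtend hk ψ) := by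
  ext i
  by_cases h : (i : ℕ) < k
  · have h1 : ∀ χ : FreeGroup (Fin k) →* FreeGroup (Fin k),
        freeGroupExtend hk χ (FreeGroup.of i) =
          FreeGroup.map (Fin.castLE hk) (χ (FreeGroup.of ⟨i, h⟩)) := by
      intro χ
      simp [freeGroupExtend, h]
    simp only [MonoidHom.comp_apply]
    rw [h1, h1, freeGroupExtend_map]
    rfl
  · simp [freeGroupExtend, h]

/-- The standard embedding `Aut(F_k) → Aut(F_n)` for `k ≤ n`: automorphisms of
`F_k = ⟨a_1, …, a_k⟩` are extended by the identity on `a_{k+1}, …, a_n`. -/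
def autFreeGroupEmbed {k n : ℕ} (hk : k ≤ n) :
    MulAut (FreeGroup (Fin k)) →* MulAut (FreeGroup (Fin n)) where
  toFun φ := MonoidHom.toMulEquiv (freeGroupExtend hk φ.toMonoidHom)
    (freeGroupExtend hk φ.symm.toMonoidHom)
    (by rw [← freeGroupExtend_comp, ← freeGroupExtend_id hk]; congr 1; ext i; simp)
    (by rw [← freeGroupExtend_comp, ← freeGroupExtend_id hk]; congr 1; ext i; simp)
  map_one' := MulEquiv.ext fun w => DFunLike.congr_fun (freeGroupExtend_id hk) w
  map_mul' φ ψ := MulEquiv.ext fun w =>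
    DFunLike.congr_fun (freeGroupExtend_comp hk φ.toMonoidHom ψ.toMonoidHom) w

/-- The copy of `Aut(F_k)` in `Aut(F_n)`. -/
def autFreeGroupSubgroup {k n : ℕ} (hk : k ≤ n) : Subgroup (MulAut (FreeGroup (Fin n))) :=
  (autFreeGroupEmbed hk).range

section

open Set Filter Topology

/-! ### Convexity in `CAT(0)` spaces -/

/-! Call an isometry elliptic if it has a fixed point. In a complete `CAT(0)` space bounded sets
have circumcenters, so finite groups have fixed points, two involutions with elliptic product have a
common fixed point, and fixed-point sets of commuting families intersect once each of them is
nonempty.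

The engine is a Helly-type bootstrap (`IsCAT0.exists_fixed_family`). Given `m` pairwise commuting
families of `k + 1` isometries, suppose that any `k` members of each family have a common fixed
point. If no family had a common fixed point, iterated geodesic interpolation would map a cube,
standing for a product of `m` simplices of dimension `k`, to `X`, and complements of fixed-point
sets would cover `X`. Sperner's lemma then puts `m * k + 1` members of any finite open refinement
through one point, so `m * k` is at most the dimension.

For `n = m + 2` and dimension less than `m`, the bootstrap is used with `k = 1` for `m` commuting
pairs of involutions. It shows that partial conjugations `a_i ↦ a_j * a_i * a_j⁻¹` and two-sided
multiplications `a_i ↦ a_j * a_i * a_j` are elliptic. They commute and their product is the square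
of the Nielsen automorphism `a_i ↦ a_j * a_i`, which is therefore elliptic too
(`exists_fixed_nielsen`).

A swap, an inversion and a shear, all involutions, generate `Aut(F₂)` by Nielsen's theorem
(`involutionSubgroup_eq_top`). Two of the three pairwise products have finite order and the third is
a Nielsen automorphism, so any two of the involutions share a fixed point. The bootstrap with `k =
2`, applied to the copies of this triple on disjoint pairs of basis elements, gives a common fixed
point of all three (`exists_fixed_rank_two_generators`).

Nielsen's theorem itself is proved by length reduction: an automorphism of minimal total length,
where simultaneous conjugation is also allowed, does not shorten words. -/

theorem exists_euclidean_triangle {a b c : ℝ} (ha : 0 ≤ a) (hb : 0 ≤ b) (hc : 0 ≤ c)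
    (hab : c ≤ a + b) (hbc : a ≤ b + c) (hca : b ≤ c + a) :
    ∃ w : Fin 3 → EuclideanSpace ℝ (Fin 2),
      dist (w 0) (w 1) = a ∧ dist (w 1) (w 2) = b ∧ dist (w 2) (w 0) = c := by
  obtain rfl | ha' := ha.eq_or_lt
  · obtain rfl : b = c := by linarith
    refine ⟨![!₂[0, 0], !₂[0, 0], !₂[b, 0]], ?_, ?_, ?_⟩ <;>
      simp [EuclideanSpace.dist_eq, Real.sqrt_sq_eq_abs, abs_of_nonneg hb, Real.dist_eq]
  -- By the law of cosines `p` is the abscissa of the third vertex; the triangle inequalities give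
  -- `|p| ≤ c`, so its height is real.
  · set p : ℝ := (a ^ 2 + c ^ 2 - b ^ 2) / (2 * a) with hp
    have hpa : 2 * a * p = a ^ 2 + c ^ 2 - b ^ 2 := by rw [hp]; field_simp
    have hpc : 0 ≤ c ^ 2 - p ^ 2 := by
      have h1 : (2 * a * p) ≤ 2 * a * c := by rw [hpa]; nlinarith
      have h2 : -(2 * a * c) ≤ 2 * a * p := by rw [hpa]; nlinarith
      have h3 : p ≤ c := le_of_mul_le_mul_left h1 (by positivity)
      have h4 : -c ≤ p := le_of_mul_le_mul_left (by linarith : 2 * a * (-c) ≤ 2 * a * p)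
        (by positivity)
      nlinarith
    refine ⟨![!₂[0, 0], !₂[a, 0], !₂[p, √(c ^ 2 - p ^ 2)]], ?_, ?_, ?_⟩
    · simp [EuclideanSpace.dist_eq, Real.dist_eq, Real.sqrt_sq_eq_abs, abs_of_nonneg ha]
    · simp only [EuclideanSpace.dist_eq, Real.dist_eq, Fin.sum_univ_two, sq_abs]
      rw [Real.sqrt_eq_iff_mul_self_eq (by positivity) hb]
      simp [Real.sq_sqrt hpc]
      nlinarith
    · simp only [EuclideanSpace.dist_eq, Real.dist_eq, Fin.sum_univ_two, sq_abs]
      rw [Real.sqrt_eq_iff_mul_self_eq (by positivity) hc]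
      simp [Real.sq_sqrt hpc]
      nlinarith

section Geometry

variable {X : Type*} [MetricSpace X]

theorem IsGeodesic.symm {γ : ℝ → X} {x y : X} (h : IsGeodesic γ x y) :
    IsGeodesic (fun t => γ (1 - t)) y x := by
  refine ⟨by simpa using h.2.1, by simpa using h.1, fun s hs t ht => ?_⟩
  have := h.2.2 (1 - s) ⟨by linarith [hs.2], by linarith [hs.1]⟩ (1 - t)
    ⟨by linarith [ht.2], by linarith [ht.1]⟩
  rw [this, dist_comm x y]
  congr 1
  rw [abs_sub_comm]
  congr 1
  ring

theorem exists_comparison_triangle (v : Fin 3 → X) :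
    ∃ w : Fin 3 → EuclideanSpace ℝ (Fin 2),
      ∀ i, dist (w i) (w (i + 1)) = dist (v i) (v (i + 1)) := by
  obtain ⟨w, h0, h1, h2⟩ := exists_euclidean_triangle (a := dist (v 0) (v 1))
    (b := dist (v 1) (v 2)) (c := dist (v 2) (v 0)) dist_nonneg dist_nonneg dist_nonneg
    (by linarith [dist_triangle (v 0) (v 1) (v 2), dist_comm (v 2) (v 0)])
    (by linarith [dist_triangle (v 1) (v 2) (v 0), dist_comm (v 0) (v 1)])
    (by linarith [dist_triangle (v 2) (v 0) (v 1), dist_comm (v 1) (v 2)])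
  refine ⟨w, fun i => ?_⟩
  fin_cases i
  · exact h0
  · exact h1
  · exact h2

theorem dist_lineMap_sq {E : Type*} [NormedAddCommGroup E] [InnerProductSpace ℝ E] (a b c : E)
    (s : ℝ) : dist (AffineMap.lineMap a b s) c ^ 2 =
      (1 - s) * dist a c ^ 2 + s * dist b c ^ 2 - s * (1 - s) * dist a b ^ 2 := by
  have h1 : AffineMap.lineMap a b s - c = (1 - s) • (a - c) + s • (b - c) := by
    rw [AffineMap.lineMap_apply_module]
    module
  have h2 : a - b = (a - c) - (b - c) := by abel
  rw [dist_eq_norm, dist_eq_norm, dist_eq_norm, dist_eq_norm, h1, h2]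
  generalize a - c = p
  generalize b - c = q
  rw [norm_add_sq_real, norm_sub_sq_real, norm_smul, norm_smul, inner_smul_left, inner_smul_right]
  simp only [mul_pow, Real.norm_eq_abs, sq_abs, conj_trivial]
  ring

namespace IsCAT0

/-- Stewart's identity `dist_lineMap_sq` in the comparison triangle; `z` enters as the initial point
of the side from `z` to `x`. -/
theorem dist_sq_le (hX : IsCAT0 X) {γ : ℝ → X} {x y : X} (h : IsGeodesic γ x y) (z : X) {s : ℝ}
    (hs : s ∈ Icc (0 : ℝ) 1) :
    dist (γ s) z ^ 2 ≤ (1 - s) * dist x z ^ 2 + s * dist y z ^ 2 - s * (1 - s) * dist x y ^ 2 := by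
  obtain ⟨γ₁, h₁⟩ := hX.exists_geodesic y z
  obtain ⟨γ₂, h₂⟩ := hX.exists_geodesic z x
  obtain ⟨w, hw⟩ := exists_comparison_triangle ![x, y, z]
  have := hX.comparison ![x, y, z] ![γ, γ₁, γ₂] w
    (by intro i; fin_cases i; exacts [h, h₁, h₂]) hw 0 2 s hs 0 ⟨le_rfl, zero_le_one⟩
  have h01 : dist (w 0) (w 1) = dist x y := hw 0
  have h12 : dist (w 1) (w 2) = dist y z := hw 1
  have h20 : dist (w 2) (w 0) = dist z x := hw 2
  have h3 : dist (γ s) z ≤ dist (AffineMap.lineMap (w 0) (w 1) s) (w 2) := by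
    simpa [h₂.1] using this
  calc dist (γ s) z ^ 2 ≤ dist (AffineMap.lineMap (w 0) (w 1) s) (w 2) ^ 2 := by gcongr
    _ = _ := by rw [dist_lineMap_sq, h01, h12, dist_comm (w 0), h20, dist_comm z x]

/-- With `z = γ' s` the right-hand side of `dist_sq_le` vanishes. -/
theorem geodesic_unique (hX : IsCAT0 X) {γ γ' : ℝ → X} {x y : X} (h : IsGeodesic γ x y)
    (h' : IsGeodesic γ' x y) {s : ℝ} (hs : s ∈ Icc (0 : ℝ) 1) : γ s = γ' s := by
  have := hX.dist_sq_le h (γ' s) hs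
  have e1 : dist x (γ' s) = s * dist x y := by
    have := h'.2.2 0 ⟨le_rfl, zero_le_one⟩ s hs
    rwa [h'.1, zero_sub, abs_neg, abs_of_nonneg hs.1] at this
  have e2 : dist y (γ' s) = (1 - s) * dist x y := by
    have := h'.2.2 1 ⟨zero_le_one, le_rfl⟩ s hs
    rwa [h'.2.1, abs_of_nonneg (by linarith [hs.2])] at this
  rw [e1, e2] at this
  have h0 : dist (γ s) (γ' s) ^ 2 ≤ 0 := by nlinarith
  exact dist_eq_zero.1 (pow_eq_zero_iff two_ne_zero |>.1 (le_antisymm h0 (sq_nonneg _)))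

/-- In the comparison triangle this is the intercept theorem. The third side runs towards `x`, hence
the parameter `1 - s`. -/
theorem dist_le_of_common_start (hX : IsCAT0 X) {γ γ' : ℝ → X} {x y y' : X}
    (h : IsGeodesic γ x y) (h' : IsGeodesic γ' x y') {s : ℝ} (hs : s ∈ Icc (0 : ℝ) 1) :
    dist (γ s) (γ' s) ≤ s * dist y y' := by
  obtain ⟨γ₁, h₁⟩ := hX.exists_geodesic y y'
  obtain ⟨w, hw⟩ := exists_comparison_triangle ![x, y, y']
  have := hX.comparison ![x, y, y'] ![γ, γ₁, fun t => γ' (1 - t)] w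
    (by intro i; fin_cases i; exacts [h, h₁, h'.symm]) hw 0 2 s hs (1 - s)
      ⟨by linarith [hs.2], by linarith [hs.1]⟩
  have h12 : dist (w 1) (w 2) = dist y y' := hw 1
  have h3 : dist (γ s) (γ' s) ≤
      dist (AffineMap.lineMap (w 0) (w 1) s) (AffineMap.lineMap (w 2) (w 0) (1 - s)) := by
    simpa using this
  rw [AffineMap.lineMap_apply_one_sub, dist_eq_norm, AffineMap.lineMap_apply_module,
    AffineMap.lineMap_apply_module] at h3
  have e : (1 - s) • w 0 + s • w 1 - ((1 - s) • w 0 + s • w 2) = s • (w 1 - w 2) := by module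
  rwa [e, norm_smul, Real.norm_eq_abs, abs_of_nonneg hs.1, ← dist_eq_norm, h12] at h3

end IsCAT0

/-- The point dividing the geodesic from `x` to `y` in the ratio `t : 1 - t`, where `t` is first
clamped to `[0, 1]`. -/
noncomputable def geodesicPoint (hX : IsCAT0 X) (t : ℝ) (x y : X) : X :=
  (hX.exists_geodesic x y).choose (projIcc 0 1 zero_le_one t)

theorem geodesicPoint_eq (hX : IsCAT0 X) {γ : ℝ → X} {x y : X} (h : IsGeodesic γ x y) {t : ℝ}
    (ht : t ∈ Icc (0 : ℝ) 1) : geodesicPoint hX t x y = γ t := by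
  rw [geodesicPoint, projIcc_of_mem _ ht]
  exact hX.geodesic_unique (hX.exists_geodesic x y).choose_spec h ht

theorem geodesicPoint_proj (hX : IsCAT0 X) (t : ℝ) (x y : X) :
    geodesicPoint hX (projIcc 0 1 zero_le_one t : Icc (0 : ℝ) 1) x y = geodesicPoint hX t x y := by
  simp [geodesicPoint]

theorem geodesicPoint_zero (hX : IsCAT0 X) (x y : X) : geodesicPoint hX 0 x y = x := by
  obtain ⟨γ, h⟩ := hX.exists_geodesic x y
  rw [geodesicPoint_eq hX h ⟨le_rfl, zero_le_one⟩, h.1]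

theorem geodesicPoint_one (hX : IsCAT0 X) (x y : X) : geodesicPoint hX 1 x y = y := by
  obtain ⟨γ, h⟩ := hX.exists_geodesic x y
  rw [geodesicPoint_eq hX h ⟨zero_le_one, le_rfl⟩, h.2.1]

theorem dist_geodesicPoint_right (hX : IsCAT0 X) {t : ℝ} (ht : t ∈ Icc (0 : ℝ) 1) (x y y' : X) :
    dist (geodesicPoint hX t x y) (geodesicPoint hX t x y') ≤ t * dist y y' := by
  obtain ⟨γ, h⟩ := hX.exists_geodesic x y
  obtain ⟨γ', h'⟩ := hX.exists_geodesic x y'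
  rw [geodesicPoint_eq hX h ht, geodesicPoint_eq hX h' ht]
  exact hX.dist_le_of_common_start h h' ht

theorem dist_geodesicPoint_left (hX : IsCAT0 X) {t : ℝ} (ht : t ∈ Icc (0 : ℝ) 1) (x x' y : X) :
    dist (geodesicPoint hX t x y) (geodesicPoint hX t x' y) ≤ (1 - t) * dist x x' := by
  obtain ⟨γ, h⟩ := hX.exists_geodesic x y
  obtain ⟨γ', h'⟩ := hX.exists_geodesic x' y
  rw [geodesicPoint_eq hX h ht, geodesicPoint_eq hX h' ht]
  have := hX.dist_le_of_common_start h.symm h'.symm (s := 1 - t)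
    ⟨by linarith [ht.2], by linarith [ht.1]⟩
  simpa using this

theorem dist_geodesicPoint_param (hX : IsCAT0 X) {s t : ℝ} (hs : s ∈ Icc (0 : ℝ) 1)
    (ht : t ∈ Icc (0 : ℝ) 1) (x y : X) :
    dist (geodesicPoint hX s x y) (geodesicPoint hX t x y) = |s - t| * dist x y := by
  obtain ⟨γ, h⟩ := hX.exists_geodesic x y
  rw [geodesicPoint_eq hX h hs, geodesicPoint_eq hX h ht, h.2.2 s hs t ht]

/-- For parameters in `[0, 1]` the three arguments are changed one at a time, each with a Lipschitz
bound; clamping extends this to all real parameters. -/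
theorem continuous_geodesicPoint (hX : IsCAT0 X) :
    Continuous fun p : ℝ × X × X => geodesicPoint hX p.1 p.2.1 p.2.2 := by
  have key : Continuous fun p : Icc (0 : ℝ) 1 × X × X => geodesicPoint hX p.1 p.2.1 p.2.2 := by
    rw [continuous_iff_continuousAt]
    rintro ⟨t, x, y⟩
    rw [ContinuousAt, tendsto_iff_dist_tendsto_zero]
    have hlim : Tendsto (fun p : Icc (0 : ℝ) 1 × X × X =>
        dist p.2.2 y + dist p.2.1 x + |(p.1 : ℝ) - t| * dist x y) (𝓝 (t, x, y)) (𝓝 0) := by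
      have : Continuous fun p : Icc (0 : ℝ) 1 × X × X =>
          dist p.2.2 y + dist p.2.1 x + |(p.1 : ℝ) - t| * dist x y := by fun_prop
      simpa using this.tendsto (t, x, y)
    refine squeeze_zero (fun _ => dist_nonneg) (fun p => ?_) hlim
    have h1 := dist_geodesicPoint_right hX p.1.2 p.2.1 p.2.2 y
    have h2 := dist_geodesicPoint_left hX p.1.2 p.2.1 x y
    have h3 := dist_geodesicPoint_param hX p.1.2 t.2 x y
    have h4 := dist_triangle4 (geodesicPoint hX p.1 p.2.1 p.2.2) (geodesicPoint hX p.1 p.2.1 y)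
      (geodesicPoint hX p.1 x y) (geodesicPoint hX t x y)
    have h5 : (p.1 : ℝ) * dist p.2.2 y ≤ dist p.2.2 y :=
      mul_le_of_le_one_left dist_nonneg p.1.2.2
    have h6 : (1 - (p.1 : ℝ)) * dist p.2.1 x ≤ dist p.2.1 x :=
      mul_le_of_le_one_left dist_nonneg (by linarith [p.1.2.1])
    linarith
  have hc : Continuous fun p : ℝ × X × X => (projIcc (0 : ℝ) 1 zero_le_one p.1, p.2) :=
    (continuous_projIcc.comp continuous_fst).prodMk continuous_snd
  convert key.comp hc using 2 with p
  exact (geodesicPoint_proj hX _ _ _).symm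

/-- A set is geodesically convex if it contains the geodesics between its points. -/
def GeodesicallyConvex (hX : IsCAT0 X) (C : Set X) : Prop :=
  ∀ x ∈ C, ∀ y ∈ C, ∀ t, geodesicPoint hX t x y ∈ C

theorem IsGeodesic.smul {G : Type*} [Group G] [MulAction G X] [IsIsometricSMul G X] {γ : ℝ → X}
    {x y : X} (h : IsGeodesic γ x y) (g : G) : IsGeodesic (fun t => g • γ t) (g • x) (g • y) :=
  ⟨by simp [h.1], by simp [h.2.1], fun s hs t ht => by simpa using h.2.2 s hs t ht⟩

theorem smul_geodesicPoint {G : Type*} [Group G] [MulAction G X] [IsIsometricSMul G X]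
    (hX : IsCAT0 X) (g : G) (t : ℝ) (x y : X) :
    g • geodesicPoint hX t x y = geodesicPoint hX t (g • x) (g • y) := by
  obtain ⟨γ, h⟩ := hX.exists_geodesic x y
  rw [← geodesicPoint_proj, ← geodesicPoint_proj hX t (g • x),
    geodesicPoint_eq hX h (Subtype.mem _), geodesicPoint_eq hX (h.smul g) (Subtype.mem _)]

theorem geodesicallyConvex_fixedBy {G : Type*} [Group G] [MulAction G X] [IsIsometricSMul G X]
    (hX : IsCAT0 X) (g : G) : GeodesicallyConvex hX (MulAction.fixedBy X g) := by
  intro x hx y hy t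
  rw [MulAction.mem_fixedBy] at *
  rw [smul_geodesicPoint, hx, hy]

theorem isClosed_fixedBy {G : Type*} [Group G] [MulAction G X] [IsIsometricSMul G X] (g : G) :
    IsClosed (MulAction.fixedBy X g) :=
  isClosed_eq (isometry_smul X g).continuous continuous_id

end Geometry

end

section

open Set Filter Topology

/-! ### Fixed points of groups with bounded orbits -/

section Center

variable {X : Type*} [MetricSpace X]

theorem IsCAT0.dist_midpoint_sq_le (hX : IsCAT0 X) (x y z : X) :
    dist (geodesicPoint hX (1 / 2) x y) z ^ 2 ≤
      dist x z ^ 2 / 2 + dist y z ^ 2 / 2 - dist x y ^ 2 / 4 := by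
  obtain ⟨γ, h⟩ := hX.exists_geodesic x y
  have hh : (1 / 2 : ℝ) ∈ Icc (0 : ℝ) 1 := by constructor <;> norm_num
  rw [geodesicPoint_eq hX h hh]
  have := hX.dist_sq_le h z hh
  linarith

/-- The circumcenter of a bounded set is fixed by all isometries that preserve the set. -/
theorem IsCAT0.exists_center [CompleteSpace X] (hX : IsCAT0 X) {O : Set X} (hne : O.Nonempty)
    (hb : Bornology.IsBounded O) :
    ∃ c : X, ∀ g : X → X, Isometry g → O ⊆ g '' O → g c = c := by
  obtain ⟨o₀, ho₀⟩ := hne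
  have : Nonempty O := ⟨⟨o₀, ho₀⟩⟩
  -- `f x` is the squared radius of the smallest ball around `x` that contains `O`.
  set f : X → ℝ := fun x => ⨆ o : O, dist x o ^ 2 with hf
  have hbdd : ∀ x : X, BddAbove (range fun o : O => dist x o ^ 2) := by
    intro x
    obtain ⟨r, hr⟩ := hb.subset_closedBall x
    refine ⟨r ^ 2, ?_⟩
    rintro _ ⟨o, rfl⟩
    have : dist x o ≤ r := by rw [dist_comm]; exact hr o.2
    dsimp only
    gcongr
  have hle : ∀ x, ∀ o ∈ O, dist x o ^ 2 ≤ f x := fun x o ho =>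
    le_ciSup (f := fun o : O => dist x o ^ 2) (hbdd x) (⟨o, ho⟩ : O)
  have hf0 : ∀ x, 0 ≤ f x := fun x => (sq_nonneg _).trans (hle x o₀ ho₀)
  have hbf : BddBelow (range f) := ⟨0, by rintro _ ⟨x, rfl⟩; exact hf0 x⟩
  set r : ℝ := ⨅ x, f x with hr
  have : Nonempty X := ⟨o₀⟩
  -- At the midpoint `f` lies below the average of its values at the ends by a quarter of the
  -- squared distance, yet not below `r`. So almost minimal points are close together: this gives
  -- both existence and uniqueness of the minimum.
  have hkey : ∀ x y, dist x y ^ 2 ≤ 2 * (f x + f y) - 4 * r := by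
    intro x y
    have h1 : r ≤ f (geodesicPoint hX (1 / 2) x y) := ciInf_le hbf _
    have h2 : f (geodesicPoint hX (1 / 2) x y) ≤ f x / 2 + f y / 2 - dist x y ^ 2 / 4 := by
      refine ciSup_le fun o => ?_
      have := hX.dist_midpoint_sq_le x y o
      have := hle x o o.2
      have := hle y o o.2
      linarith
    linarith
  have hseq : ∀ n : ℕ, ∃ x, f x < r + 1 / (n + 1) := fun n =>
    exists_lt_of_ciInf_lt (lt_add_of_pos_right _ (by positivity))
  choose x hx using hseq
  have hlim : Tendsto (fun n : ℕ => 4 * (1 / ((n : ℝ) + 1))) atTop (𝓝 0) := by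
    simpa using tendsto_one_div_add_atTop_nhds_zero_nat.const_mul (4 : ℝ)
  have hcau : CauchySeq x := by
    refine cauchySeq_of_le_tendsto_0 (fun n : ℕ => √(4 * (1 / ((n : ℝ) + 1)))) ?_
      (by simpa using hlim.sqrt)
    intro n m N hn hm
    refine Real.le_sqrt_of_sq_le ?_
    have h1 := hkey (x n) (x m)
    have h2 : 1 / ((n : ℝ) + 1) ≤ 1 / (N + 1) := by gcongr
    have h3 : 1 / ((m : ℝ) + 1) ≤ 1 / (N + 1) := by gcongr
    linarith [hx n, hx m]
  obtain ⟨c, hc⟩ := cauchySeq_tendsto_of_complete hcau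
  have hcr : ∀ o ∈ O, dist c o ^ 2 ≤ r := by
    intro o ho
    have h1 : Tendsto (fun n => dist (x n) o ^ 2) atTop (𝓝 (dist c o ^ 2)) :=
      (hc.dist tendsto_const_nhds).pow 2
    have h2 : Tendsto (fun n : ℕ => r + 1 / ((n : ℝ) + 1)) atTop (𝓝 r) := by
      simpa using tendsto_one_div_add_atTop_nhds_zero_nat.const_add r
    exact le_of_tendsto_of_tendsto' h1 h2 fun n => (hle _ _ ho).trans (hx n).le
  refine ⟨c, fun g hg hO => ?_⟩
  have h1 : f c ≤ r := ciSup_le fun o => hcr o o.2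
  have h2 : f (g c) ≤ r := by
    refine ciSup_le fun o => ?_
    obtain ⟨o', ho', e⟩ := hO o.2
    rw [← e, hg.dist_eq]
    exact hcr o' ho'
  have h3 := hkey (g c) c
  have h4 : dist (g c) c ^ 2 ≤ 0 := by linarith
  exact dist_eq_zero.1 (pow_eq_zero_iff two_ne_zero |>.1 (le_antisymm h4 (sq_nonneg _)))

variable {G : Type*} [Group G] [MulAction G X] [IsIsometricSMul G X] [CompleteSpace X]

theorem IsCAT0.exists_fixed_of_bounded (hX : IsCAT0 X) {O : Set X} (hne : O.Nonempty)
    (hb : Bornology.IsBounded O) :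
    ∃ c : X, ∀ g : G, (∀ o ∈ O, ∃ o' ∈ O, g • o' = o) → g • c = c := by
  obtain ⟨c, hc⟩ := hX.exists_center hne hb
  exact ⟨c, fun g hg => hc _ (isometry_smul X g) fun o ho => hg o ho⟩

/-- The first `k` points of the `g`-orbit of a fixed point of `g ^ k` form a finite invariant set,
whose circumcenter is fixed. -/
theorem IsCAT0.exists_fixed_of_pow (hX : IsCAT0 X) {g : G} {k : ℕ} (hk : 0 < k)
    (h : ∃ x : X, g ^ k • x = x) : ∃ x : X, g • x = x := by
  obtain ⟨p, hp⟩ := h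
  obtain ⟨c, hc⟩ := hX.exists_fixed_of_bounded (G := G)
    (O := (fun j : ℕ => g ^ j • p) '' Iio k) ⟨_, 0, hk, rfl⟩
    ((finite_Iio k).image _).isBounded
  refine ⟨c, hc g ?_⟩
  rintro _ ⟨j, hj, rfl⟩
  rcases j with _ | j
  · refine ⟨_, ⟨k - 1, ?_, rfl⟩, ?_⟩
    · simp only [mem_Iio]; omega
    · dsimp only
      rw [smul_smul, ← pow_succ', Nat.sub_add_cancel hk, hp, pow_zero, one_smul]
  · refine ⟨_, ⟨j, ?_, rfl⟩, ?_⟩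
    · simp only [mem_Iio] at *; omega
    · dsimp only
      rw [smul_smul, ← pow_succ']

/-- Two involutions with elliptic product have a common fixed point. -/
theorem IsCAT0.exists_fixed_of_involutions (hX : IsCAT0 X) {a b : G} (ha : a * a = 1)
    (hb : b * b = 1) (h : ∃ x : X, (a * b) • x = x) : ∃ x : X, a • x = x ∧ b • x = x := by
  obtain ⟨p, hp⟩ := h
  -- Hence both involutions preserve `{p, a • p}`.
  have hbp : b • p = a • p := by
    conv_rhs => rw [← hp]
    rw [smul_smul, ← mul_assoc, ha, one_mul]
  obtain ⟨c, hc⟩ := hX.exists_fixed_of_bounded (G := G) (O := {p, a • p}) ⟨p, by simp⟩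
    (toFinite _).isBounded
  refine ⟨c, hc a ?_, hc b ?_⟩
  · rintro o (rfl | rfl)
    · exact ⟨a • o, by simp, by rw [smul_smul, ha, one_smul]⟩
    · exact ⟨p, by simp, rfl⟩
  · rintro o (rfl | rfl)
    · exact ⟨a • o, by simp, by rw [← hbp, smul_smul, hb, one_smul]⟩
    · exact ⟨p, by simp, hbp⟩

/-- Let `p` be fixed by `S` and `q` by `T`. The orbit of `p` under the group generated by `T` lies
in a ball around `q`, is invariant under `T`, and is fixed pointwise by `S` because of commutation.
Its circumcenter is the required point. -/
theorem IsCAT0.exists_fixed_union (hX : IsCAT0 X) {S T : Set G}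
    (hST : ∀ s ∈ S, ∀ t ∈ T, Commute s t) (hS : ∃ x : X, ∀ s ∈ S, s • x = x)
    (hT : ∃ x : X, ∀ t ∈ T, t • x = x) : ∃ x : X, ∀ g ∈ S ∪ T, g • x = x := by
  obtain ⟨p, hp⟩ := hS
  obtain ⟨q, hq⟩ := hT
  have hq' : ∀ h ∈ Subgroup.closure T, h • q = q := by
    intro h hh
    have : Subgroup.closure T ≤ MulAction.stabilizer G q := by
      rw [Subgroup.closure_le]
      exact fun t ht => hq t ht
    exact this hh
  obtain ⟨c, hc⟩ := hX.exists_fixed_of_bounded (G := G)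
    (O := (fun h : G => h • p) '' (Subgroup.closure T : Set G)) ⟨_, 1, one_mem _, rfl⟩ (by
      refine (Metric.isBounded_closedBall (x := q) (r := dist p q)).subset ?_
      rintro _ ⟨h, hh, rfl⟩
      rw [Metric.mem_closedBall]
      conv_lhs => rw [← hq' h hh]
      rw [dist_smul])
  refine ⟨c, ?_⟩
  rintro g (hg | hg)
  · refine hc g ?_
    rintro _ ⟨h, hh, rfl⟩
    refine ⟨_, ⟨h, hh, rfl⟩, ?_⟩
    have : h ∈ Subgroup.centralizer {g} := by
      have hle : Subgroup.closure T ≤ Subgroup.centralizer {g} := by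
        rw [Subgroup.closure_le]
        intro t ht
        rw [SetLike.mem_coe, Subgroup.mem_centralizer_singleton_iff]
        exact (hST g hg t ht).eq.symm
      exact hle hh
    rw [Subgroup.mem_centralizer_singleton_iff] at this
    dsimp only
    rw [smul_smul, ← this, mul_smul, hp g hg]
  · refine hc g ?_
    rintro _ ⟨h, hh, rfl⟩
    have hg' := Subgroup.subset_closure hg
    exact ⟨_, ⟨g⁻¹ * h, mul_mem (inv_mem hg') hh, rfl⟩, by
      dsimp only; rw [smul_smul, mul_inv_cancel_left]⟩

theorem IsCAT0.exists_fixed_mul (hX : IsCAT0 X) {a b : G} (hab : Commute a b)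
    (ha : ∃ x : X, a • x = x) (hb : ∃ x : X, b • x = x) : ∃ x : X, (a * b) • x = x := by
  obtain ⟨x, hx⟩ := hX.exists_fixed_union (S := {a}) (T := {b}) (by simpa using hab)
    (by simpa using ha) (by simpa using hb)
  exact ⟨x, by rw [mul_smul, hx b (by simp), hx a (by simp)]⟩

theorem IsCAT0.exists_fixed_iUnion [Nonempty X] (hX : IsCAT0 X) {ι : Type*} [Finite ι]
    {S : ι → Set G} (hS : ∀ i j, i ≠ j → ∀ s ∈ S i, ∀ t ∈ S j, Commute s t)
    (h : ∀ i, ∃ x : X, ∀ s ∈ S i, s • x = x) : ∃ x : X, ∀ i, ∀ s ∈ S i, s • x = x := by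
  classical
  have := Fintype.ofFinite ι
  suffices H : ∀ F : Finset ι, ∃ x : X, ∀ i ∈ F, ∀ s ∈ S i, s • x = x by
    obtain ⟨x, hx⟩ := H Finset.univ
    exact ⟨x, fun i => hx i (Finset.mem_univ i)⟩
  intro F
  induction F using Finset.induction_on with
  | empty => exact ⟨Classical.arbitrary X, by simp⟩
  | insert i F hi ih =>
    obtain ⟨x, hx⟩ := ih
    obtain ⟨y, hy⟩ := hX.exists_fixed_union (S := S i) (T := ⋃ j ∈ F, S j)
      (by
        intro s hs t ht
        simp only [mem_iUnion] at ht
        obtain ⟨j, hj, ht⟩ := ht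
        exact hS i j (by rintro rfl; exact hi hj) s hs t ht)
      (h i)
      ⟨x, by
        intro t ht
        simp only [mem_iUnion] at ht
        obtain ⟨j, hj, ht⟩ := ht
        exact hx j hj t ht⟩
    refine ⟨y, fun j hj s hs => hy s ?_⟩
    rcases Finset.mem_insert.1 hj with rfl | hj
    · exact Or.inl hs
    · exact Or.inr (mem_iUnion₂.2 ⟨j, hj, hs⟩)

end Center

end

section

open Set Filter Topology

/-! ### Sperner's lemma on the cube -/

section Sperner

open Equiv

/-- The vertices of the simplex of the Kuhn triangulation with lowest vertex `v` that moves in the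
coordinate directions in the order prescribed by `ρ`. -/
def kuhnVertex {N : ℕ} (v : Fin N → ℕ) (ρ : Perm (Fin N)) (k : Fin (N + 1)) : Fin N → ℕ :=
  fun i => v i + if (ρ i : ℕ) < k then 1 else 0

/-- A facet of a labelled simplex is a door if it carries all labels but `0`. -/
def IsDoor {m : ℕ} (g : Fin (m + 1) → Fin (m + 1)) (k : Fin (m + 1)) : Prop :=
  ∀ j : Fin m, ∃ k', k' ≠ k ∧ g k' = j.succ

/-- Pigeonhole: the `m` vertices of the facet carry `m` prescribed labels, so each label occurs once
and `0` does not occur. -/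
theorem IsDoor.injOn {m : ℕ} {g : Fin (m + 1) → Fin (m + 1)} {k : Fin (m + 1)} (h : IsDoor g k) :
    Set.InjOn g {k' | k' ≠ k} ∧ ∀ k' ≠ k, g k' ≠ 0 := by
  classical
  choose w hw hgw using h
  have hwinj : Function.Injective w := fun i j hij => by
    have := hgw i
    rw [hij, hgw j] at this
    exact (Fin.succ_injective _ this).symm
  have hsurj : ∀ k' ≠ k, ∃ j, w j = k' := by
    intro k' hk'
    have himg : Finset.univ.image w = Finset.univ.erase k := by
      apply Finset.eq_of_subset_of_card_le
      · intro x hx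
        obtain ⟨j, -, rfl⟩ := Finset.mem_image.1 hx
        exact Finset.mem_erase.2 ⟨hw j, Finset.mem_univ _⟩
      · rw [Finset.card_image_of_injective _ hwinj, Finset.card_erase_of_mem (Finset.mem_univ _)]
        simp
    have : k' ∈ Finset.univ.image w := by
      rw [himg]
      exact Finset.mem_erase.2 ⟨hk', Finset.mem_univ _⟩
    obtain ⟨j, -, rfl⟩ := Finset.mem_image.1 this
    exact ⟨j, rfl⟩
  constructor
  · intro x hx y hy hxy
    obtain ⟨i, rfl⟩ := hsurj x hx
    obtain ⟨j, rfl⟩ := hsurj y hy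
    rw [hgw, hgw] at hxy
    rw [Fin.succ_injective _ hxy]
  · intro k' hk'
    obtain ⟨j, rfl⟩ := hsurj k' hk'
    rw [hgw]
    exact Fin.succ_ne_zero j

-- A rainbow simplex has one door, opposite its vertex with label `0`. Any other simplex has no door
-- or exactly two, opposite the two vertices that share a label.
open Classical in
theorem card_doors {m : ℕ} (g : Fin (m + 1) → Fin (m + 1)) :
    ((Finset.univ.filter fun k => IsDoor g k).card : ZMod 2) =
      if Function.Surjective g then 1 else 0 := by
  split_ifs with hg
  · have hinj : Function.Injective g := Finite.injective_iff_surjective.2 hg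
    obtain ⟨k₀, hk₀⟩ := hg 0
    have : (Finset.univ.filter fun k => IsDoor g k) = {k₀} := by
      ext k
      simp only [Finset.mem_filter, Finset.mem_univ, true_and, Finset.mem_singleton]
      constructor
      · intro h
        by_contra hne
        exact h.injOn.2 k₀ (Ne.symm hne) hk₀
      · rintro rfl j
        obtain ⟨k', hk'⟩ := hg j.succ
        refine ⟨k', ?_, hk'⟩
        rintro rfl
        rw [hk₀] at hk'
        exact (Fin.succ_ne_zero j) hk'.symm
    rw [this]
    simp
  · by_cases hD : ∃ k, IsDoor g k
    · obtain ⟨k, hk⟩ := hD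
      have h0 : g k ≠ 0 := by
        intro h0
        apply hg
        intro y
        induction y using Fin.cases with
        | zero => exact ⟨k, h0⟩
        | succ j => obtain ⟨k', -, h⟩ := hk j; exact ⟨k', h⟩
      obtain ⟨j₀, hj₀⟩ := Fin.exists_succ_eq.2 h0
      obtain ⟨k₁, hk₁, hgk₁⟩ := hk j₀
      rw [hj₀] at hgk₁
      have : (Finset.univ.filter fun k => IsDoor g k) = {k, k₁} := by
        ext x
        simp only [Finset.mem_filter, Finset.mem_univ, true_and, Finset.mem_singleton,
          Finset.mem_insert]
        constructor
        · intro hx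
          by_contra! hne
          obtain ⟨j, hj⟩ := Fin.exists_succ_eq.2 (hk.injOn.2 x hne.1)
          have h1 : g k = g k₁ := hgk₁.symm
          exact hk₁ ((hx.injOn.1 hne.1.symm hne.2.symm h1).symm)
        · rintro (rfl | rfl)
          · exact hk
          · intro j
            obtain ⟨k', hk', hg'⟩ := hk j
            by_cases h : k' = x
            · subst h
              exact ⟨k, hk₁.symm, by rw [← hgk₁, hg']⟩
            · exact ⟨k', h, hg'⟩
      rw [this, Finset.card_pair hk₁.symm]
      rfl
    · have : (Finset.univ.filter fun k => IsDoor g k) = ∅ := by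
        ext x
        simp only [Finset.mem_filter, Finset.mem_univ, true_and, Finset.notMem_empty, iff_false]
        exact fun h => hD ⟨x, h⟩
      rw [this]
      simp

/-- The simplex on the other side of the facet opposite the lowest vertex. -/
def kuhnUp {n : ℕ} (σ : (Fin (n + 1) → ℕ) × Perm (Fin (n + 1))) :
    (Fin (n + 1) → ℕ) × Perm (Fin (n + 1)) :=
  (Function.update σ.1 (σ.2.symm 0) (σ.1 (σ.2.symm 0) + 1), σ.2.trans (finRotate (n + 1)).symm)

/-- The simplex on the other side of the facet opposite the highest vertex. -/
def kuhnDown {n : ℕ} (σ : (Fin (n + 1) → ℕ) × Perm (Fin (n + 1))) :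
    (Fin (n + 1) → ℕ) × Perm (Fin (n + 1)) :=
  (Function.update σ.1 (σ.2.symm (Fin.last n)) (σ.1 (σ.2.symm (Fin.last n)) - 1),
    σ.2.trans (finRotate (n + 1)))

theorem finRotate_symm_zero (n : ℕ) : (finRotate (n + 1)).symm 0 = Fin.last n := by
  rw [Equiv.symm_apply_eq, finRotate_last]

theorem kuhnUp_symm_last {n : ℕ} (σ : (Fin (n + 1) → ℕ) × Perm (Fin (n + 1))) :
    (kuhnUp σ).2.symm (Fin.last n) = σ.2.symm 0 := by
  simp [kuhnUp]

theorem kuhnDown_symm_zero {n : ℕ} (σ : (Fin (n + 1) → ℕ) × Perm (Fin (n + 1))) :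
    (kuhnDown σ).2.symm 0 = σ.2.symm (Fin.last n) := by
  simp only [kuhnDown, Equiv.symm_trans_apply, finRotate_symm_zero]

theorem kuhnDown_kuhnUp {n : ℕ} (σ : (Fin (n + 1) → ℕ) × Perm (Fin (n + 1))) :
    kuhnDown (kuhnUp σ) = σ := by
  unfold kuhnDown
  rw [kuhnUp_symm_last]
  ext i <;> simp [kuhnUp]

/-- The hypothesis is needed because `kuhnDown` uses truncated subtraction; at coordinate `0` the
facet lies in the boundary of the cube. -/
theorem kuhnUp_kuhnDown {n : ℕ} (σ : (Fin (n + 1) → ℕ) × Perm (Fin (n + 1)))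
    (h : σ.1 (σ.2.symm (Fin.last n)) ≠ 0) : kuhnUp (kuhnDown σ) = σ := by
  unfold kuhnUp
  rw [kuhnDown_symm_zero]
  ext i
  · simp [kuhnDown, Nat.sub_add_cancel (Nat.pos_of_ne_zero h)]
  · simp [kuhnDown]

/-- Going up drops the lowest vertex and appends a new highest one, so the shared facet reappears
with indices shifted by one. -/
theorem kuhnVertex_kuhnUp {n : ℕ} (σ : (Fin (n + 1) → ℕ) × Perm (Fin (n + 1)))
    (j : Fin (n + 1)) :
    kuhnVertex (kuhnUp σ).1 (kuhnUp σ).2 j.castSucc = kuhnVertex σ.1 σ.2 j.succ := by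
  ext i
  by_cases hi : i = σ.2.symm 0
  · subst hi
    simp [kuhnVertex, kuhnUp, j.is_le]
  · have h0 : σ.2 i ≠ 0 := fun h => hi (by rw [← h, symm_apply_apply])
    obtain ⟨r, hr⟩ := Fin.exists_succ_eq.2 h0
    have h1 : (finRotate (n + 1)).symm r.succ = r.castSucc := by
      rw [Equiv.symm_apply_eq]
      simp
    simp [kuhnVertex, kuhnUp, hi, ← hr, h1]

/-- Exchanging two consecutive moves affects only the vertex visited between them. -/
theorem kuhnVertex_swap {n : ℕ} (v : Fin (n + 1) → ℕ) (ρ : Perm (Fin (n + 1))) (b : Fin n)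
    (k' : Fin (n + 2)) (hk : k' ≠ b.succ.castSucc) :
    kuhnVertex v (ρ.trans (swap b.castSucc b.succ)) k' = kuhnVertex v ρ k' := by
  ext i
  have hk' : (k' : ℕ) ≠ b + 1 := fun h => hk (Fin.ext (by simpa using h))
  simp only [kuhnVertex, trans_apply]
  congr 2
  rw [swap_apply_def]
  split_ifs with h1 h2
  · rw [h1]
    simp
    omega
  · rw [h2]
    simp
    omega
  · rfl

/-- The labels of the vertices of a grid of side `M` avoid on the boundary of the grid the values
that are forbidden in Sperner's lemma on the cube. -/
def IsCubeLabelling {N : ℕ} (M : ℕ) (l : (Fin N → ℕ) → Fin (N + 1)) : Prop :=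
  ∀ x : Fin N → ℕ, (∀ i, x i ≤ M) → ∀ i, (x i = 0 → l x ≠ i.succ) ∧ (x i = M → i.succ ≤ l x)

theorem kuhnVertex_le {N M : ℕ} {v : Fin N → ℕ} (hv : ∀ i, v i < M) (ρ : Perm (Fin N))
    (k : Fin (N + 1)) (i : Fin N) : kuhnVertex v ρ k i ≤ M := by
  have := hv i
  unfold kuhnVertex
  split_ifs <;> omega

/-- The neighbouring simplex across a facet, together with the index of this facet in it. -/
def kuhnFlip {n : ℕ} (x : ((Fin (n + 1) → ℕ) × Perm (Fin (n + 1))) × Fin (n + 2)) :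
    ((Fin (n + 1) → ℕ) × Perm (Fin (n + 1))) × Fin (n + 2) :=
  Fin.cases (motive := fun _ => ((Fin (n + 1) → ℕ) × Perm (Fin (n + 1))) × Fin (n + 2))
    (kuhnUp x.1, Fin.last _)
    (fun k => Fin.lastCases
      (motive := fun _ => ((Fin (n + 1) → ℕ) × Perm (Fin (n + 1))) × Fin (n + 2))
      (kuhnDown x.1, 0)
      (fun b => ((x.1.1, x.1.2.trans (swap b.castSucc b.succ)), b.succ.castSucc)) k) x.2

theorem kuhnFlip_zero {n : ℕ} (σ : (Fin (n + 1) → ℕ) × Perm (Fin (n + 1))) :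
    kuhnFlip (σ, 0) = (kuhnUp σ, Fin.last _) := rfl

theorem kuhnFlip_last {n : ℕ} (σ : (Fin (n + 1) → ℕ) × Perm (Fin (n + 1))) :
    kuhnFlip (σ, Fin.last _) = (kuhnDown σ, 0) := by
  have h : kuhnFlip (σ, (Fin.last n).succ) = (kuhnDown σ, 0) := by
    simp only [kuhnFlip, Fin.cases_succ, Fin.lastCases_last]
  exact h

theorem kuhnFlip_mid {n : ℕ} (σ : (Fin (n + 1) → ℕ) × Perm (Fin (n + 1))) (b : Fin n) :
    kuhnFlip (σ, b.succ.castSucc) =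
      ((σ.1, σ.2.trans (swap b.castSucc b.succ)), b.succ.castSucc) := by
  rw [← Fin.succ_castSucc]
  simp [kuhnFlip]

theorem isDoor_zero {m : ℕ} (g : Fin (m + 1) → Fin (m + 1)) :
    IsDoor g 0 ↔ ∀ j : Fin m, ∃ k' : Fin m, g k'.succ = j.succ := by
  refine forall_congr' fun j => ?_
  constructor
  · rintro ⟨k', h0, h⟩
    obtain ⟨r, rfl⟩ := Fin.exists_succ_eq.2 h0
    exact ⟨r, h⟩
  · rintro ⟨k', h⟩
    exact ⟨k'.succ, Fin.succ_ne_zero _, h⟩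

theorem isDoor_last {m : ℕ} (g : Fin (m + 1) → Fin (m + 1)) :
    IsDoor g (Fin.last m) ↔ ∀ j : Fin m, ∃ k' : Fin m, g k'.castSucc = j.succ := by
  refine forall_congr' fun j => ?_
  constructor
  · rintro ⟨k', h0, h⟩
    obtain ⟨r, rfl⟩ := Fin.exists_castSucc_eq.2 h0
    exact ⟨r, h⟩
  · rintro ⟨k', h⟩
    exact ⟨k'.castSucc, (Fin.castSucc_lt_last _).ne, h⟩

theorem fin_cases_three {n : ℕ} {P : Fin (n + 2) → Prop} (h0 : P 0) (hl : P (Fin.last _))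
    (hm : ∀ b : Fin n, P b.succ.castSucc) (k : Fin (n + 2)) : P k := by
  induction k using Fin.lastCases with
  | last => exact hl
  | cast k =>
    induction k using Fin.cases with
    | zero => exact h0
    | succ b => exact hm b

/-- The doors in the interior of the cube. -/
def InteriorDoor {n : ℕ} (M : ℕ) (l : (Fin (n + 1) → ℕ) → Fin (n + 2))
    (x : ((Fin (n + 1) → ℕ) × Perm (Fin (n + 1))) × Fin (n + 2)) : Prop :=
  (∀ i, x.1.1 i < M) ∧ IsDoor (fun k => l (kuhnVertex x.1.1 x.1.2 k)) x.2 ∧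
    (x.2 = 0 → x.1.1 (x.1.2.symm 0) + 1 < M) ∧
    (x.2 = Fin.last _ → x.1.1 (x.1.2.symm (Fin.last n)) ≠ 0)

/-- Both simplices adjacent to an interior facet see the same labels on it, so crossing the facet
pairs off interior doors; they cancel modulo 2. -/
theorem InteriorDoor.flip {n M : ℕ} {l : (Fin (n + 1) → ℕ) → Fin (n + 2)}
    {x : ((Fin (n + 1) → ℕ) × Perm (Fin (n + 1))) × Fin (n + 2)} (hx : InteriorDoor M l x) :
    InteriorDoor M l (kuhnFlip x) ∧ kuhnFlip x ≠ x ∧ kuhnFlip (kuhnFlip x) = x := by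
  obtain ⟨σ, k⟩ := x
  obtain ⟨hv, hd, h0, hl⟩ := hx
  have hne : (0 : Fin (n + 2)) ≠ Fin.last _ := (Fin.last_pos).ne
  induction k using fin_cases_three with
  | h0 =>
    have h0 := h0 rfl
    rw [kuhnFlip_zero]
    refine ⟨⟨?_, ?_, fun h => absurd h.symm hne, fun _ => ?_⟩, fun h => hne (congrArg Prod.snd h).symm, ?_⟩
    · intro i
      dsimp only [kuhnUp]
      by_cases hi : i = σ.2.symm 0
      · subst hi
        simpa using h0
      · simpa [hi] using hv i
    · dsimp only
      rw [isDoor_last]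
      simpa only [kuhnVertex_kuhnUp] using (isDoor_zero _).1 hd
    · dsimp only
      rw [kuhnUp_symm_last]
      simp [kuhnUp]
    · rw [kuhnFlip_last, kuhnDown_kuhnUp]
  | hl =>
    have hl := hl rfl
    have hup := kuhnUp_kuhnDown σ hl
    rw [kuhnFlip_last]
    refine ⟨⟨?_, ?_, fun _ => ?_, fun h => absurd h hne⟩, fun h => hne (congrArg Prod.snd h), ?_⟩
    · intro i
      dsimp only [kuhnDown]
      by_cases hi : i = σ.2.symm (Fin.last n)
      · subst hi
        have := hv (σ.2.symm (Fin.last n))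
        dsimp only at this
        simp
        omega
      · simpa [hi] using hv i
    · dsimp only
      rw [isDoor_zero]
      have := (isDoor_last _).1 hd
      rw [← hup] at this
      simpa only [kuhnVertex_kuhnUp] using this
    · dsimp only
      rw [kuhnDown_symm_zero]
      have := hv (σ.2.symm (Fin.last n))
      simp only [kuhnDown, Function.update_self] at *
      omega
    · rw [kuhnFlip_zero, hup]
  | hm b =>
    have hb : b.castSucc ≠ b.succ := Fin.castSucc_lt_succ.ne
    rw [kuhnFlip_mid]
    refine ⟨⟨hv, ?_, fun h => ?_, fun h => absurd h (Fin.castSucc_lt_last _).ne⟩, fun h => ?_, ?_⟩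
    · intro j
      obtain ⟨k', hk', h⟩ := hd j
      exact ⟨k', hk', by dsimp only at h ⊢; rw [kuhnVertex_swap _ _ _ _ hk', h]⟩
    · exact absurd (congrArg Fin.val h) (by simp)
    · have h1 : σ.2.trans (swap b.castSucc b.succ) = σ.2 :=
        congrArg Prod.snd (congrArg Prod.fst h)
      have h2 := congrArg (fun e : Perm (Fin (n + 1)) => e (σ.2.symm b.castSucc)) h1
      simp at h2
      exact hb h2.symm
    · rw [kuhnFlip_mid]
      ext <;> simp

end Sperner

end

/-! ### Parity of rainbow simplices and covers of the cube -/

section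

open Set Filter Topology

section Sperner

open Equiv

/-- The permutation moves coordinate `0` first, and this move reaches the value `M`. The remaining
vertices form a simplex of the lower-dimensional cube inside the face where that coordinate is `M`.
-/
theorem kuhnVertex_cons {n M : ℕ} (hM : 0 < M) (v : Fin n → ℕ) (ρ : Perm (Fin n))
    (k : Fin (n + 1)) :
    kuhnVertex (Fin.cons (M - 1) v : Fin (n + 1) → ℕ) (Equiv.Perm.decomposeFin.symm (0, ρ)) k.succ =
      (Fin.cons M (kuhnVertex v ρ k) : Fin (n + 1) → ℕ) := by
  ext i
  induction i using Fin.cases with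
  | zero => simp [kuhnVertex]; omega
  | succ i => simp [kuhnVertex]

/-- The labelling induced on the facet of the cube where the first coordinate is maximal. -/
theorem IsCubeLabelling.facet {n M : ℕ} {l : (Fin (n + 1) → ℕ) → Fin (n + 2)}
    (hl : IsCubeLabelling M l) :
    IsCubeLabelling M (fun y => (0 : Fin (n + 1)).predAbove (l (Fin.cons M y))) ∧
      ∀ y : Fin n → ℕ, (∀ i, y i ≤ M) →
        ((0 : Fin (n + 1)).predAbove (l (Fin.cons M y))).succ = l (Fin.cons M y) := by
  have hc : ∀ y : Fin n → ℕ, (∀ i, y i ≤ M) → ∀ i, (Fin.cons M y : Fin (n + 1) → ℕ) i ≤ M := by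
    intro y hy i
    induction i using Fin.cases with
    | zero => simp
    | succ i => simpa using hy i
  -- On this face the label `0` is forbidden, so `predAbove` lowers every label by one.
  have h2 : ∀ y : Fin n → ℕ, (∀ i, y i ≤ M) →
        ((0 : Fin (n + 1)).predAbove (l (Fin.cons M y))).succ = l (Fin.cons M y) := by
    intro y hy
    have h1 := (hl _ (hc y hy) 0).2 (by simp)
    have h0 : l (Fin.cons M y) ≠ 0 := by
      intro h
      rw [h] at h1
      simp at h1
    obtain ⟨j, hj⟩ := Fin.exists_succ_eq.2 h0
    rw [← hj]
    simp
  refine ⟨fun y hy i => ⟨fun h0 h => ?_, fun hM => ?_⟩, h2⟩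
  · refine (hl _ (hc y hy) i.succ).1 (by simpa using h0) ?_
    rw [← h2 y hy]
    exact congrArg Fin.succ h
  · have := (hl _ (hc y hy) i.succ).2 (by simpa using hM)
    rw [← h2 y hy] at this
    exact Fin.succ_le_succ_iff.1 this

open Classical in
/-- The number of simplices of the Kuhn triangulation that carry all labels is odd. -/
theorem card_rainbow (N : ℕ) {M : ℕ} (hM : 0 < M) (l : (Fin N → ℕ) → Fin (N + 1))
    (hl : IsCubeLabelling M l) :
    (((Fintype.piFinset (fun _ : Fin N => Finset.range M) ×ˢ (Finset.univ : Finset (Perm (Fin N)))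
      ).filter fun σ => Function.Surjective fun k => l (kuhnVertex σ.1 σ.2 k)).card : ZMod 2) =
      1 := by
  induction N with
  | zero =>
    rw [Finset.filter_true_of_mem]
    · simp
    · intro σ _ y
      exact ⟨0, (Subsingleton.elim (α := Fin 1) _ _)⟩
  | succ n ih =>
    set S := Fintype.piFinset (fun _ : Fin (n + 1) => Finset.range M) ×ˢ
      (Finset.univ : Finset (Perm (Fin (n + 1)))) with hS
    have hmem : ∀ σ, σ ∈ S ↔ ∀ i, σ.1 i < M := by
      intro σ
      simp [hS, Fintype.mem_piFinset]
    have h1 : ((S.filter fun σ => Function.Surjective fun k => l (kuhnVertex σ.1 σ.2 k)).card :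
        ZMod 2) = ∑ x ∈ S ×ˢ Finset.univ,
          if IsDoor (fun k => l (kuhnVertex x.1.1 x.1.2 k)) x.2 then (1 : ZMod 2) else 0 := by
      rw [Finset.card_filter, Finset.sum_product (s := S)]
      push_cast
      refine Finset.sum_congr rfl fun σ _ => ?_
      rw [← card_doors, Finset.card_filter]
      push_cast
      rfl
    -- A door in the boundary can only lie in an upper face: a facet in the face where coordinate
    -- `i` is `0` lacks the label `i.succ`.
    have h2 : ∀ x ∈ S ×ˢ (Finset.univ : Finset (Fin (n + 2))),
        (if IsDoor (fun k => l (kuhnVertex x.1.1 x.1.2 k)) x.2 then (1 : ZMod 2) else 0) =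
        (if InteriorDoor M l x then 1 else 0) +
        if IsDoor (fun k => l (kuhnVertex x.1.1 x.1.2 k)) x.2 ∧ x.2 = 0 ∧
          x.1.1 (x.1.2.symm 0) + 1 = M then 1 else 0 := by
      rintro ⟨σ, k⟩ hx
      have hv : ∀ i, σ.1 i < M := (hmem σ).1 (Finset.mem_product.1 hx).1
      by_cases hd : IsDoor (fun k => l (kuhnVertex σ.1 σ.2 k)) k
      · have hlast : k = Fin.last _ → σ.1 (σ.2.symm (Fin.last n)) ≠ 0 := by
          rintro rfl h0
          obtain ⟨k', hk'⟩ := (isDoor_last _).1 hd (σ.2.symm (Fin.last n))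
          refine (hl _ (kuhnVertex_le hv σ.2 k'.castSucc) _).1 ?_ hk'
          simp [kuhnVertex, h0, k'.is_le]
        by_cases hB : k = 0 ∧ σ.1 (σ.2.symm 0) + 1 = M
        · have : ¬ InteriorDoor M l (σ, k) := fun h => by
            have := h.2.2.1 hB.1
            have := hB.2
            dsimp only at *
            omega
          rw [if_pos hd, if_neg this, if_pos ⟨hd, hB⟩, zero_add]
        · have : InteriorDoor M l (σ, k) := by
            refine ⟨hv, hd, fun h => ?_, hlast⟩
            have := hv (σ.2.symm 0)
            have : σ.1 (σ.2.symm 0) + 1 ≠ M := fun h' => hB ⟨h, h'⟩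
            dsimp only
            omega
          rw [if_pos hd, if_pos this, if_neg fun h => hB h.2, add_zero]
      · have : ¬ InteriorDoor M l (σ, k) := fun h => hd h.2.1
        rw [if_neg hd, if_neg this, if_neg fun h => hd h.1, add_zero]
    have h3 : ∑ x ∈ S ×ˢ (Finset.univ : Finset (Fin (n + 2))),
        (if InteriorDoor M l x then (1 : ZMod 2) else 0) = 0 := by
      rw [← Finset.sum_filter]
      refine Finset.sum_involution (fun x _ => kuhnFlip x) ?_ ?_ ?_ ?_
      · intro x _
        rfl
      · intro x hx _
        exact (Finset.mem_filter.1 hx).2.flip.2.1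
      · intro x hx
        have := (Finset.mem_filter.1 hx).2.flip.1
        exact Finset.mem_filter.2 ⟨Finset.mem_product.2 ⟨(hmem _).2 this.1, Finset.mem_univ _⟩, this⟩
      · intro x hx
        exact (Finset.mem_filter.1 hx).2.flip.2.2
    obtain ⟨hl', hsucc⟩ := hl.facet
    rw [h1, Finset.sum_congr rfl h2, Finset.sum_add_distrib, h3, zero_add,
      ← Finset.sum_filter, Finset.sum_const, nsmul_eq_mul, mul_one, ← ih _ hl']
    congr 1
    symm
    have hdoor : ∀ (v : Fin n → ℕ) (ρ : Perm (Fin n)), (∀ i, v i < M) →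
        (IsDoor (fun k => l (kuhnVertex (Fin.cons (M - 1) v : Fin (n + 1) → ℕ)
          (Equiv.Perm.decomposeFin.symm (0, ρ)) k)) 0 ↔ Function.Surjective fun k =>
            (0 : Fin (n + 1)).predAbove (l (Fin.cons M (kuhnVertex v ρ k)))) := by
      intro v ρ hv
      rw [isDoor_zero]
      refine forall_congr' fun j => exists_congr fun k => ?_
      rw [kuhnVertex_cons hM, ← hsucc _ (kuhnVertex_le hv ρ k)]
      simp
    refine Finset.card_bij (fun σ _ => (((Fin.cons (M - 1) σ.1 : Fin (n + 1) → ℕ),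
      Equiv.Perm.decomposeFin.symm (0, σ.2)), (0 : Fin (n + 2)))) ?_ ?_ ?_
    · rintro ⟨v, ρ⟩ hσ
      simp only [Finset.mem_filter, Finset.mem_product, Fintype.mem_piFinset, Finset.mem_range,
        Finset.mem_univ, and_true] at hσ
      have hz : (Equiv.Perm.decomposeFin.symm (0, ρ)).symm 0 = 0 := by
        rw [Equiv.symm_apply_eq, Equiv.Perm.decomposeFin_symm_apply_zero]
      simp only [Finset.mem_filter, Finset.mem_product, Finset.mem_univ, and_true, hmem]
      refine ⟨fun i => ?_, (hdoor v ρ hσ.1).2 hσ.2, trivial, ?_⟩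
      · induction i using Fin.cases with
        | zero => simpa using hM
        | succ i => simpa using hσ.1 i
      · rw [hz]
        simp
        omega
    · rintro ⟨v, ρ⟩ _ ⟨v', ρ'⟩ _ h
      simp only [Prod.mk.injEq, and_true, EmbeddingLike.apply_eq_iff_eq, true_and] at h
      rw [h.2, Fin.cons_right_injective _ h.1]
    · rintro ⟨⟨v, ρ⟩, k⟩ hx
      simp only [Finset.mem_filter, Finset.mem_product, Finset.mem_univ, and_true, hmem] at hx
      obtain ⟨hv, hd, rfl, hvM⟩ := hx
      obtain ⟨⟨p, e⟩, rfl⟩ := Equiv.Perm.decomposeFin.symm.surjective ρ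
      set ρ := Equiv.Perm.decomposeFin.symm (p, e) with hρ
      -- In the upper face of coordinate `i` all labels are at least `i.succ`, whereas a door
      -- carries the label `1`; so `i = 0`.
      have h0 : ρ.symm 0 = 0 := by
        obtain ⟨k', hk'⟩ := (isDoor_zero _).1 hd 0
        have := (hl _ (kuhnVertex_le hv ρ k'.succ) (ρ.symm 0)).2 (by simp [kuhnVertex, hvM])
        rw [hk', Fin.succ_le_succ_iff] at this
        exact le_antisymm this (Fin.zero_le _)
      have hp : p = 0 := by
        rw [Equiv.symm_apply_eq, hρ, Equiv.Perm.decomposeFin_symm_apply_zero] at h0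
        exact h0.symm
      rw [h0] at hvM
      have hvc : v = Fin.cons (M - 1) (Fin.tail v) := by
        have : v 0 = M - 1 := by
          omega
        rw [← this, Fin.cons_self_tail]
      have hv' : ∀ i, Fin.tail v i < M := fun i => hv _
      rw [hvc, hρ, hp] at hd
      refine ⟨(Fin.tail v, e), ?_, ?_⟩
      · simp only [Finset.mem_filter, Finset.mem_product, Fintype.mem_piFinset, Finset.mem_range,
          Finset.mem_univ, and_true]
        exact ⟨hv', (hdoor _ _ hv').1 hd⟩
      · dsimp only
        rw [← hvc, hρ, hp]

/-- **Sperner's lemma** on the cube. -/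
theorem exists_rainbow {N M : ℕ} (hM : 0 < M) {l : (Fin N → ℕ) → Fin (N + 1)}
    (hl : IsCubeLabelling M l) : ∃ (v : Fin N → ℕ) (ρ : Perm (Fin N)), (∀ i, v i < M) ∧
      Function.Surjective fun k => l (kuhnVertex v ρ k) := by
  classical
  have h := card_rainbow N hM l hl
  have hne : ((Fintype.piFinset (fun _ : Fin N => Finset.range M) ×ˢ
      (Finset.univ : Finset (Perm (Fin N)))).filter fun σ =>
        Function.Surjective fun k => l (kuhnVertex σ.1 σ.2 k)).Nonempty := by
    rw [Finset.nonempty_iff_ne_empty]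
    intro h0
    rw [h0] at h
    simp at h
  obtain ⟨σ, hσ⟩ := hne
  simp only [Finset.mem_filter, Finset.mem_product, Fintype.mem_piFinset, Finset.mem_range,
    Finset.mem_univ, and_true] at hσ
  exact ⟨σ.1, σ.2, hσ⟩

/-- Open covers of the cube that are subject to the boundary conditions of Sperner's lemma have a
common point. -/
theorem exists_mem_forall_of_cube_cover {N : ℕ} {W : Fin (N + 1) → Set (Fin N → ℝ)}
    (hW : ∀ j, IsOpen (W j)) (hcov : Icc (0 : Fin N → ℝ) 1 ⊆ ⋃ j, W j)
    (h0 : ∀ x ∈ Icc (0 : Fin N → ℝ) 1, ∀ i, x i = 0 → x ∉ W i.succ)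
    (h1 : ∀ x ∈ Icc (0 : Fin N → ℝ) 1, ∀ i, x i = 1 → ∀ j, x ∈ W j → i.succ ≤ j) :
    ∃ x ∈ Icc (0 : Fin N → ℝ) 1, ∀ j, x ∈ W j := by
  -- Each grid point gets as label the index of a set that contains the whole `δ`-ball around it.
  -- With mesh below `δ`, the lowest vertex of a rainbow simplex lies in all these balls, so no
  -- limit is needed.
  obtain ⟨δ, hδ, hleb⟩ := lebesgue_number_lemma_of_metric isCompact_Icc hW hcov
  obtain ⟨m, hm⟩ := exists_nat_one_div_lt hδ
  set M : ℕ := m + 1 with hMdef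
  have hM : (0 : ℝ) < M := by positivity
  set pt : (Fin N → ℕ) → Fin N → ℝ := fun x i => x i / M with hpt
  have hmem : ∀ x : Fin N → ℕ, (∀ i, x i ≤ M) → pt x ∈ Icc (0 : Fin N → ℝ) 1 := by
    intro x hx
    refine ⟨fun i => by simp only [hpt, Pi.zero_apply]; positivity, fun i => ?_⟩
    simp only [hpt, Pi.one_apply]
    rw [div_le_one hM]
    exact_mod_cast hx i
  have hex : ∀ x : Fin N → ℕ, ∃ j, (∀ i, x i ≤ M) → Metric.ball (pt x) δ ⊆ W j := by
    intro x
    by_cases hx : ∀ i, x i ≤ M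
    · obtain ⟨j, hj⟩ := hleb _ (hmem x hx)
      exact ⟨j, fun _ => hj⟩
    · exact ⟨0, fun h => absurd h hx⟩
  choose l hl using hex
  have hlW : ∀ x : Fin N → ℕ, (∀ i, x i ≤ M) → pt x ∈ W (l x) := fun x hx =>
    hl x hx (Metric.mem_ball_self hδ)
  have hlab : IsCubeLabelling M l := by
    refine fun x hx i => ⟨fun hi h => ?_, fun hi => ?_⟩
    · refine h0 _ (hmem x hx) i (by simp [hpt, hi]) ?_
      rw [← h]
      exact hlW x hx
    · exact h1 _ (hmem x hx) i (by simp [hpt, hi, hM.ne']) _ (hlW x hx)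
  obtain ⟨v, ρ, hv, hsurj⟩ := exists_rainbow (Nat.succ_pos m) hlab
  refine ⟨pt v, hmem v fun i => (hv i).le, fun j => ?_⟩
  obtain ⟨k, rfl⟩ := hsurj j
  refine hl _ (kuhnVertex_le hv ρ k) ?_
  rw [Metric.mem_ball, dist_pi_lt_iff hδ]
  intro i
  rw [Real.dist_eq]
  have hm' : 1 / (M : ℝ) < δ := by simpa [hMdef] using hm
  refine lt_of_le_of_lt ?_ hm'
  simp only [hpt, kuhnVertex]
  rw [← sub_div, abs_div, abs_of_pos hM]
  gcongr
  split_ifs <;> simp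

end Sperner

end

section

open Set Filter Topology

/-! ### A Helly theorem for joins of convex sets -/

section Helly

variable {X : Type*} [MetricSpace X]

/-- Iterated geodesic interpolation between `k + 1` points, with `k` parameters. -/
noncomputable def blockPoint (hX : IsCAT0 X) : (k : ℕ) → (Fin (k + 1) → X) → (Fin k → ℝ) → X
  | 0, q, _ => q 0
  | k + 1, q, x => geodesicPoint hX (x (Fin.last k)) (blockPoint hX k (Fin.init q) (Fin.init x))
      (q (Fin.last (k + 1)))

theorem continuous_blockPoint (hX : IsCAT0 X) (k : ℕ) :
    Continuous fun p : (Fin (k + 1) → X) × (Fin k → ℝ) => blockPoint hX k p.1 p.2 := by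
  induction k with
  | zero =>
    simp only [blockPoint]
    fun_prop
  | succ k ih =>
    have h1 : Continuous fun p : (Fin (k + 2) → X) × (Fin (k + 1) → ℝ) =>
        blockPoint hX k (Fin.init p.1) (Fin.init p.2) := by
      refine ih.comp (Continuous.prodMk ?_ ?_)
      · exact continuous_pi fun i => (continuous_apply i.castSucc).comp continuous_fst
      · exact continuous_pi fun i => (continuous_apply i.castSucc).comp continuous_snd
    have h2 : Continuous fun p : (Fin (k + 2) → X) × (Fin (k + 1) → ℝ) =>
        (p.2 (Fin.last k), blockPoint hX k (Fin.init p.1) (Fin.init p.2),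
          p.1 (Fin.last (k + 1))) := by
      fun_prop
    exact (continuous_geodesicPoint hX).comp h2

theorem blockPoint_mem (hX : IsCAT0 X) {C : Set X} (hC : GeodesicallyConvex hX C) {k : ℕ}
    {q : Fin (k + 1) → X} (hq : ∀ r, q r ∈ C) (x : Fin k → ℝ) : blockPoint hX k q x ∈ C := by
  induction k with
  | zero => exact hq 0
  | succ k ih => exact hC _ (ih (fun r => hq _) _) _ (hq _) _

/-- The condition on the parameters that forces the weight of the `r`-th point to vanish. -/
def WeightZero {k : ℕ} (x : Fin k → ℝ) (r : Fin (k + 1)) : Prop :=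
  (∃ t : Fin k, r = t.succ ∧ x t = 0) ∨ ∃ t : Fin k, r ≤ t.castSucc ∧ x t = 1

/-- Either the parameter `0` leaves out the `r`-th point when it is due, or a later parameter `1`
discards everything interpolated before it. -/
theorem blockPoint_mem_of_weightZero (hX : IsCAT0 X) {C : Set X} (hC : GeodesicallyConvex hX C)
    {k : ℕ} {q : Fin (k + 1) → X} {r : Fin (k + 1)} (hq : ∀ r', r' ≠ r → q r' ∈ C)
    {x : Fin k → ℝ} (hx : WeightZero x r) : blockPoint hX k q x ∈ C := by
  induction k with
  | zero => rcases hx with ⟨t, -⟩ | ⟨t, -⟩ <;> exact t.elim0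
  | succ k ih =>
    rw [blockPoint]
    induction r using Fin.lastCases with
    | last =>
      have hinit : blockPoint hX k (Fin.init q) (Fin.init x) ∈ C :=
        blockPoint_mem hX hC (fun r => hq _ (Fin.castSucc_lt_last r).ne) _
      rcases hx with ⟨t, ht, h0⟩ | ⟨t, ht, -⟩
      · rw [← Fin.succ_last] at ht
        rw [Fin.succ_injective _ ht, h0, geodesicPoint_zero]
        exact hinit
      · exact absurd (Fin.castSucc_lt_last t) (not_lt.2 ht)
    | cast r =>
      have hlast := hq (Fin.last (k + 1)) (Fin.castSucc_lt_last r).ne'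
      by_cases h1 : x (Fin.last k) = 1
      · rw [h1, geodesicPoint_one]
        exact hlast
      · refine hC _ (ih (r := r) ?_ ?_) _ hlast _
        · intro r' hr'
          exact hq _ fun h => hr' (Fin.castSucc_injective _ h)
        · rcases hx with ⟨t, ht, h0⟩ | ⟨t, ht, ht1⟩
          · left
            induction t using Fin.lastCases with
            | last =>
              rw [Fin.succ_last] at ht
              exact absurd ht (Fin.castSucc_lt_last r).ne
            | cast t =>
              refine ⟨t, ?_, h0⟩
              rw [Fin.succ_castSucc] at ht
              exact Fin.castSucc_injective _ ht
          · right
            induction t using Fin.lastCases with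
            | last => exact absurd ht1 h1
            | cast t => exact ⟨t, Fin.castSucc_le_castSucc_iff.1 ht, ht1⟩

/-- Iterated geodesic interpolation over a product of simplices. -/
noncomputable def joinPoint (hX : IsCAT0 X) (k : ℕ) :
    (m : ℕ) → ((Fin m → Fin (k + 1)) → X) → (Fin m → Fin k → ℝ) → X
  | 0, p, _ => p Fin.elim0
  | m + 1, p, x =>
    blockPoint hX k (fun t => joinPoint hX k m (fun s => p (Fin.cons t s)) (Fin.tail x)) (x 0)

theorem continuous_joinPoint (hX : IsCAT0 X) (k m : ℕ) (p : (Fin m → Fin (k + 1)) → X) :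
    Continuous (joinPoint hX k m p) := by
  induction m with
  | zero => exact continuous_const
  | succ m ih =>
    have h1 : Continuous fun x : Fin (m + 1) → Fin k → ℝ =>
        (fun t => joinPoint hX k m (fun s => p (Fin.cons t s)) (Fin.tail x), x 0) := by
      refine Continuous.prodMk (continuous_pi fun t => (ih _).comp ?_) (continuous_apply 0)
      exact continuous_pi fun i => continuous_apply i.succ
    exact (continuous_blockPoint hX k).comp h1

theorem joinPoint_mem (hX : IsCAT0 X) {C : Set X} (hC : GeodesicallyConvex hX C) {k m : ℕ}
    {p : (Fin m → Fin (k + 1)) → X} (hp : ∀ s, p s ∈ C) (x : Fin m → Fin k → ℝ) :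
    joinPoint hX k m p x ∈ C := by
  induction m with
  | zero => exact hp _
  | succ m ih => exact blockPoint_mem hX hC (fun r => ih (fun s => hp _) _) _

theorem joinPoint_mem_of_weightZero (hX : IsCAT0 X) {C : Set X} (hC : GeodesicallyConvex hX C)
    {k m : ℕ} {p : (Fin m → Fin (k + 1)) → X} {i : Fin m} {r : Fin (k + 1)}
    (hp : ∀ s, s i ≠ r → p s ∈ C) {x : Fin m → Fin k → ℝ} (hx : WeightZero (x i) r) :
    joinPoint hX k m p x ∈ C := by
  induction m with
  | zero => exact i.elim0
  | succ m ih =>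
    rw [joinPoint]
    induction i using Fin.cases with
    | zero =>
      refine blockPoint_mem_of_weightZero hX hC (r := r) (fun r' hr' => ?_) hx
      exact joinPoint_mem hX hC (fun s => hp _ (by simpa using hr')) _
    | succ i =>
      refine blockPoint_mem hX hC (fun r' => ih (i := i) (fun s hs => hp _ (by simpa using hs)) ?_) _
      exact hx

theorem finProdFinEquiv_lt {m k : ℕ} {i i' : Fin m} {t t' : Fin k}
    (h : finProdFinEquiv (i, t) < finProdFinEquiv (i', t')) : i < i' ∨ i = i' ∧ t < t' := by
  have h' : (t : ℕ) + k * i < t' + k * i' := h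
  rcases lt_trichotomy i i' with hi | rfl | hi
  · exact Or.inl hi
  · right
    exact ⟨rfl, by rw [Fin.lt_def]; omega⟩
  · have h1 : (i' : ℕ) + 1 ≤ i := hi
    have h2 : k * (i' + 1) ≤ k * i := Nat.mul_le_mul_left _ h1
    have := t'.2
    rw [mul_add] at h2
    omega

/-- The label of a choice of one vertex in each of `m` simplices. -/
theorem exists_label {m k : ℕ} (τ : Fin m → Fin (k + 1)) : ∃ L : Fin (m * k + 1),
    (∀ i t, L = (finProdFinEquiv (i, t)).succ → τ i = t.succ) ∧
    ∀ i t, L < (finProdFinEquiv (i, t)).succ → τ i ≤ t.castSucc := by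
  by_cases hτ : ∃ i, τ i ≠ 0
  -- The label records the last factor `i` in which `τ` is nonzero, together with its value there.
  -- Larger labels belong to later factors, where `τ` is zero, or to larger values in the same
  -- factor.
  · obtain ⟨i, hi, hmax⟩ := Finset.exists_max_image (Finset.univ.filter fun i => τ i ≠ 0) id
      (by obtain ⟨i, hi⟩ := hτ; exact ⟨i, by simpa using hi⟩)
    simp only [Finset.mem_filter, Finset.mem_univ, true_and, id] at hi hmax
    obtain ⟨t, ht⟩ := Fin.exists_succ_eq.2 hi
    refine ⟨(finProdFinEquiv (i, t)).succ, fun i' t' h => ?_, fun i' t' h => ?_⟩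
    · obtain ⟨rfl, rfl⟩ := Prod.mk.inj (finProdFinEquiv.injective (Fin.succ_injective _ h))
      exact ht.symm
    · rcases finProdFinEquiv_lt (Fin.succ_lt_succ_iff.1 h) with h | ⟨rfl, ht'⟩
      · have : τ i' = 0 := by
          by_contra hne
          exact absurd (hmax i' hne) (not_le.2 h)
        rw [this]
        exact Fin.zero_le _
      · rw [← ht]
        exact ht'
  · push Not at hτ
    exact ⟨0, fun i t h => absurd h.symm (Fin.succ_ne_zero _), fun i t _ => by
      rw [hτ i]; exact Fin.zero_le _⟩

/-- Suppose that `m * k` is larger than the covering dimension. If in each of `m` families of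
`k + 1` closed convex sets one can leave out a member so that the remaining sets of all families
intersect, for every choice of the left out members, then some family intersects. -/
theorem IsCAT0.exists_mem_iInter (hX : IsCAT0 X) {d m k : ℕ} (hd : CoveringDimLE X d)
    (hdm : d < m * k) (C : Fin m → Fin (k + 1) → Set X) (hclosed : ∀ i t, IsClosed (C i t))
    (hconv : ∀ i t, GeodesicallyConvex hX (C i t))
    (hne : ∀ τ : Fin m → Fin (k + 1), ∃ p, ∀ i t, t ≠ τ i → p ∈ C i t) :
    ∃ i, ∃ p, ∀ t, p ∈ C i t := by
  by_contra! hcon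
  choose p hp using hne
  -- As no family intersects, each point avoids some member of every family; these choices index an
  -- open cover.
  set U : Set (Set X) := range fun τ : Fin m → Fin (k + 1) => ⋂ i, (C i (τ i))ᶜ with hU
  obtain ⟨V, -, hVo, hVc, hVU, hVord⟩ := hd U (finite_range _)
    (by
      rintro _ ⟨τ, rfl⟩
      exact isOpen_iInter_of_finite fun i => (hclosed _ _).isOpen_compl)
    (by
      refine eq_univ_of_forall fun x => ?_
      choose τ hτ using fun i => hcon i x
      exact ⟨_, ⟨τ, rfl⟩, mem_iInter.2 hτ⟩)
  have hlabel : ∀ v : Set X, ∃ L : Fin (m * k + 1), v ∈ V → ∃ τ : Fin m → Fin (k + 1),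
      (∀ x ∈ v, ∀ i, x ∉ C i (τ i)) ∧
      (∀ i t, L = (finProdFinEquiv (i, t)).succ → τ i = t.succ) ∧
      ∀ i t, L < (finProdFinEquiv (i, t)).succ → τ i ≤ t.castSucc := by
    intro v
    by_cases hv : v ∈ V
    · obtain ⟨_, ⟨τ, rfl⟩, hvu⟩ := hVU v hv
      obtain ⟨L, h1, h2⟩ := exists_label τ
      exact ⟨L, fun _ => ⟨τ, fun x hx i => mem_iInter.1 (hvu hx) i, h1, h2⟩⟩
    · exact ⟨0, fun h => absurd h hv⟩
  choose L hL using hlabel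
  set f : (Fin (m * k) → ℝ) → X := fun x =>
    joinPoint hX k m p fun i t => x (finProdFinEquiv (i, t)) with hf
  have hfc : Continuous f := (continuous_joinPoint hX k m p).comp <|
    continuous_pi fun i => continuous_pi fun t => continuous_apply _
  -- Where vertex `r` of factor `i` has weight zero, `f x` is interpolated from points `p s` with `s
  -- i ≠ r`, all in `C i r`. A member of `V` avoiding `C i r` cannot contain such a value, which
  -- yields both boundary conditions below.
  have hfmem : ∀ x i r, WeightZero (fun t => x (finProdFinEquiv (i, t))) r → f x ∈ C i r := by
    intro x i r h
    exact joinPoint_mem_of_weightZero hX (hconv i r) (i := i) (r := r)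
      (fun s hs => hp s i r (Ne.symm hs)) h
  obtain ⟨x, -, hx⟩ := exists_mem_forall_of_cube_cover
    (W := fun j => f ⁻¹' ⋃₀ {v ∈ V | L v = j})
    (fun j => (isOpen_sUnion fun v hv => hVo v hv.1).preimage hfc)
    (by
      intro x _
      obtain ⟨v, hv, hxv⟩ : f x ∈ ⋃₀ V := by rw [hVc]; trivial
      exact mem_iUnion.2 ⟨L v, v, ⟨hv, rfl⟩, hxv⟩)
    (by
      rintro x - j h0 ⟨v, ⟨hv, hLv⟩, hxv⟩
      obtain ⟨⟨i, t⟩, rfl⟩ := finProdFinEquiv.surjective j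
      obtain ⟨τ, h1, h2, -⟩ := hL v hv
      refine h1 _ hxv i (hfmem x i _ ?_)
      exact Or.inl ⟨t, h2 i t hLv, h0⟩)
    (by
      rintro x - j h0 _ ⟨v, ⟨hv, rfl⟩, hxv⟩
      by_contra! hlt
      obtain ⟨⟨i, t⟩, rfl⟩ := finProdFinEquiv.surjective j
      obtain ⟨τ, h1, -, h3⟩ := hL v hv
      refine h1 _ hxv i (hfmem x i _ ?_)
      exact Or.inr ⟨t, h3 i t hlt, h0⟩)
  -- Different labels give different members of `V`, so `m * k + 1` of them contain `f x`.
  choose v hv hxv using hx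
  have hinj : Function.Injective v := fun a b h => by
    rw [← (hv a).2, ← (hv b).2, h]
  have hcard := (encard_le_encard (s := range v) (t := {u ∈ V | f x ∈ u}) (by
    rintro _ ⟨j, rfl⟩
    exact ⟨(hv j).1, hxv j⟩)).trans (hVord (f x))
  rw [← image_univ, hinj.encard_image, encard_univ, ENat.card_eq_coe_fintype_card,
    Fintype.card_fin] at hcard
  have : m * k + 1 ≤ d + 1 := by exact_mod_cast hcard
  omega

variable {G : Type*} [Group G] [MulAction G X] [IsIsometricSMul G X] [CompleteSpace X] [Nonempty X]

/-- The bootstrap principle: if `m` families of `k + 1` isometries commute pairwise, any `k`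
members of each family have a common fixed point, and the covering dimension is less than `m * k`,
then some family has a common fixed point. -/
theorem IsCAT0.exists_fixed_family (hX : IsCAT0 X) {d m k : ℕ} (hd : CoveringDimLE X d)
    (hdm : d < m * k) (s : Fin m → Fin (k + 1) → G)
    (hcomm : ∀ i i', i ≠ i' → ∀ t t', Commute (s i t) (s i' t'))
    (hfix : ∀ i t, ∃ x : X, ∀ t', t' ≠ t → s i t' • x = x) :
    ∃ i, ∃ x : X, ∀ t, s i t • x = x := by
  refine hX.exists_mem_iInter hd hdm (fun i t => MulAction.fixedBy X (s i t))
    (fun i t => isClosed_fixedBy _) (fun i t => geodesicallyConvex_fixedBy hX _) fun τ => ?_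
  obtain ⟨x, hx⟩ := hX.exists_fixed_iUnion (S := fun i => {g | ∃ t, t ≠ τ i ∧ g = s i t})
    (by
      rintro i j hij _ ⟨t, -, rfl⟩ _ ⟨t', -, rfl⟩
      exact hcomm i j hij t t')
    (fun i => by
      obtain ⟨x, hx⟩ := hfix i (τ i)
      refine ⟨x, ?_⟩
      rintro _ ⟨t, ht, rfl⟩
      exact hx t ht)
  exact ⟨x, fun i t ht => hx i _ ⟨t, ht, rfl⟩⟩

/-- The bootstrap principle for pairs of involutions. -/
theorem IsCAT0.exists_fixed_mul_of_involutions (hX : IsCAT0 X) {d m : ℕ} (hd : CoveringDimLE X d)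
    (hdm : d < m) (a b : Fin m → G) (ha : ∀ i, a i * a i = 1) (hb : ∀ i, b i * b i = 1)
    (hcomm : ∀ i j, i ≠ j →
      Commute (a i) (a j) ∧ Commute (a i) (b j) ∧ Commute (b i) (a j) ∧ Commute (b i) (b j)) :
    ∃ i, ∃ x : X, (a i * b i) • x = x := by
  have hinv : ∀ g : G, g * g = 1 → ∃ x : X, g • x = x := fun g hg =>
    hX.exists_fixed_of_pow two_pos ⟨Classical.arbitrary X, by rw [pow_two, hg, one_smul]⟩
  obtain ⟨i, x, hx⟩ := hX.exists_fixed_family (k := 1) hd (by simpa using hdm)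
    (fun i => ![a i, b i])
    (by
      intro i j hij t t'
      obtain ⟨h1, h2, h3, h4⟩ := hcomm i j hij
      fin_cases t <;> fin_cases t' <;> assumption)
    (by
      intro i t
      fin_cases t
      · obtain ⟨x, hx⟩ := hinv _ (hb i)
        refine ⟨x, fun t' ht' => ?_⟩
        fin_cases t'
        · exact absurd rfl ht'
        · exact hx
      · obtain ⟨x, hx⟩ := hinv _ (ha i)
        refine ⟨x, fun t' ht' => ?_⟩
        fin_cases t'
        · exact hx
        · exact absurd rfl ht')
  have h0 : a i • x = x := hx 0
  have h1 : b i • x = x := hx 1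
  exact ⟨i, x, by rw [mul_smul, h1, h0]⟩

end Helly

end

section

open Set Filter Topology

/-! ### Some automorphisms of free groups -/

section Automorphisms

open FreeGroup (of)
open Equiv

variable {n : ℕ}

theorem mulAut_freeGroup_ext {α : Type*} {φ ψ : MulAut (FreeGroup α)}
    (h : ∀ i, φ (of i) = ψ (of i)) : φ = ψ := by
  have : φ.toMonoidHom = ψ.toMonoidHom := FreeGroup.ext_hom _ _ fun i => h i
  exact MulEquiv.ext fun w => DFunLike.congr_fun this w

/-- The endomorphism `a_i ↦ a_j ^ p_i * a_i * a_j ^ (-q_i)` for `i ≠ j`, `a_j ↦ a_j`. -/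
def transvectionHom (j : Fin n) (p q : Fin n → ℤ) : FreeGroup (Fin n) →* FreeGroup (Fin n) :=
  FreeGroup.lift fun i => if i = j then of j else of j ^ p i * of i * of j ^ (-q i)

theorem transvectionHom_self (j : Fin n) (p q : Fin n → ℤ) :
    transvectionHom j p q (of j) = of j := by
  simp [transvectionHom]

theorem transvectionHom_of_ne {i j : Fin n} (h : i ≠ j) (p q : Fin n → ℤ) :
    transvectionHom j p q (of i) = of j ^ p i * of i * of j ^ (-q i) := by
  simp [transvectionHom, h]

theorem transvectionHom_comp (j : Fin n) (p q p' q' : Fin n → ℤ) :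
    (transvectionHom j p q).comp (transvectionHom j p' q') =
      transvectionHom j (p + p') (q + q') := by
  refine FreeGroup.ext_hom _ _ fun i => ?_
  by_cases h : i = j
  · subst h
    simp [transvectionHom_self]
  · rw [MonoidHom.comp_apply, transvectionHom_of_ne h, transvectionHom_of_ne h, map_mul, map_mul,
      map_zpow, map_zpow, transvectionHom_self, transvectionHom_of_ne h, Pi.add_apply, Pi.add_apply]
    group

theorem transvectionHom_zero (j : Fin n) : transvectionHom j 0 0 = MonoidHom.id _ := by
  refine FreeGroup.ext_hom _ _ fun i => ?_
  by_cases h : i = j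
  · subst h
    simp [transvectionHom_self]
  · simp [transvectionHom_of_ne h]

/-- The automorphism `a_i ↦ a_j ^ p_i * a_i * a_j ^ (-q_i)` for `i ≠ j`, `a_j ↦ a_j`. -/
def transvection (j : Fin n) (p q : Fin n → ℤ) : MulAut (FreeGroup (Fin n)) :=
  MonoidHom.toMulEquiv (transvectionHom j p q) (transvectionHom j (-p) (-q))
    (by rw [transvectionHom_comp, neg_add_cancel, neg_add_cancel, transvectionHom_zero])
    (by rw [transvectionHom_comp, add_neg_cancel, add_neg_cancel, transvectionHom_zero])

theorem transvection_self (j : Fin n) (p q : Fin n → ℤ) : transvection j p q (of j) = of j :=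
  transvectionHom_self j p q

theorem transvection_of_ne {i j : Fin n} (h : i ≠ j) (p q : Fin n → ℤ) :
    transvection j p q (of i) = of j ^ p i * of i * of j ^ (-q i) :=
  transvectionHom_of_ne h p q

theorem transvection_mul (j : Fin n) (p q p' q' : Fin n → ℤ) :
    transvection j p q * transvection j p' q' = transvection j (p + p') (q + q') :=
  MulEquiv.ext fun w => DFunLike.congr_fun (transvectionHom_comp j p q p' q') w

theorem transvection_zero (j : Fin n) : transvection j 0 0 = 1 :=
  MulEquiv.ext fun w => DFunLike.congr_fun (transvectionHom_zero j) w

theorem transvection_commute (j : Fin n) (p q p' q' : Fin n → ℤ) :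
    Commute (transvection j p q) (transvection j p' q') := by
  rw [commute_iff_eq, transvection_mul, transvection_mul, add_comm p, add_comm q]

/-- The endomorphism inverting the `i`-th basis element. -/
def inversionHom (i : Fin n) : FreeGroup (Fin n) →* FreeGroup (Fin n) :=
  FreeGroup.lift fun k => if k = i then (of k)⁻¹ else of k

theorem inversionHom_comp_self (i : Fin n) :
    (inversionHom i).comp (inversionHom i) = MonoidHom.id _ := by
  refine FreeGroup.ext_hom _ _ fun k => ?_
  by_cases h : k = i <;> simp [inversionHom, h]

/-- The automorphism inverting the `i`-th basis element. -/
def inversion (i : Fin n) : MulAut (FreeGroup (Fin n)) :=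
  MonoidHom.toMulEquiv (inversionHom i) (inversionHom i) (inversionHom_comp_self i)
    (inversionHom_comp_self i)

theorem inversion_self (i : Fin n) : inversion i (of i) = (of i)⁻¹ := by
  change inversionHom i (of i) = _
  simp [inversionHom]

theorem inversion_of_ne {i k : Fin n} (h : k ≠ i) : inversion i (of k) = of k := by
  change inversionHom i (of k) = _
  simp [inversionHom, h]

theorem inversion_mul_self (i : Fin n) : inversion i * inversion i = 1 :=
  MulEquiv.ext fun w => DFunLike.congr_fun (inversionHom_comp_self i) w

/-- The automorphism permuting the basis. -/
def basisPerm (π : Perm (Fin n)) : MulAut (FreeGroup (Fin n)) := FreeGroup.freeGroupCongr π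

theorem basisPerm_of (π : Perm (Fin n)) (i : Fin n) : basisPerm π (of i) = of (π i) := by
  simp [basisPerm]

theorem basisPerm_swap_mul_self (x y : Fin n) :
    basisPerm (swap x y) * basisPerm (swap x y) = 1 := by
  refine mulAut_freeGroup_ext fun i => ?_
  simp [basisPerm_of]

theorem inversion_commute (i j : Fin n) : Commute (inversion i) (inversion j) := by
  refine mulAut_freeGroup_ext fun k => ?_
  simp only [MulAut.mul_apply]
  by_cases hi : k = i <;> by_cases hj : k = j
  · subst hi; subst hj; rfl
  · subst hi
    rw [inversion_of_ne hj, inversion_self, map_inv, inversion_of_ne hj]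
  · subst hj
    rw [inversion_of_ne hi, inversion_self, map_inv, inversion_of_ne hi]
  · rw [inversion_of_ne hi, inversion_of_ne hj, inversion_of_ne hi]

theorem inversion_mul_transvection (j : Fin n) (p q : Fin n → ℤ) :
    inversion j * transvection j p q = transvection j (-p) (-q) * inversion j := by
  refine mulAut_freeGroup_ext fun k => ?_
  simp only [MulAut.mul_apply]
  by_cases h : k = j
  · subst h
    rw [transvection_self, inversion_self, map_inv, transvection_self]
  · rw [transvection_of_ne h, inversion_of_ne h, transvection_of_ne h]
    simp [inversion_self, inversion_of_ne h]

/-- Inverting `a_j ^ p * a_i * a_j ^ (-q)` exchanges the two exponents. -/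
theorem inversion_mul_transvection_of_ne {i j : Fin n} (hij : i ≠ j) (p q : Fin n → ℤ) :
    inversion i * transvection j p q =
      transvection j (Function.update p i (q i)) (Function.update q i (p i)) * inversion i := by
  refine mulAut_freeGroup_ext fun k => ?_
  simp only [MulAut.mul_apply]
  by_cases h : k = j
  · subst h
    rw [transvection_self, inversion_of_ne hij.symm, transvection_self]
  · by_cases hk : k = i
    · subst hk
      rw [transvection_of_ne h, inversion_self, map_inv, transvection_of_ne h]
      simp [inversion_self, inversion_of_ne hij.symm, mul_assoc]
    · rw [transvection_of_ne h, inversion_of_ne hk, transvection_of_ne h]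
      simp [hk, inversion_of_ne hij.symm, inversion_of_ne hk]

theorem inversion_commute_transvection {i j : Fin n} (hij : i ≠ j) {p q : Fin n → ℤ}
    (h : p i = q i) : Commute (inversion i) (transvection j p q) := by
  rw [commute_iff_eq, inversion_mul_transvection_of_ne hij, ← h, Function.update_eq_self, h,
    Function.update_eq_self]

theorem basisPerm_mul_transvection (π : Perm (Fin n)) (j : Fin n) (p q : Fin n → ℤ) :
    basisPerm π * transvection j p q =
      transvection (π j) (p ∘ π.symm) (q ∘ π.symm) * basisPerm π := by
  refine mulAut_freeGroup_ext fun k => ?_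
  simp only [MulAut.mul_apply]
  by_cases h : k = j
  · subst h
    rw [transvection_self, basisPerm_of, transvection_self]
  · rw [transvection_of_ne h, basisPerm_of, transvection_of_ne (fun h' => h (π.injective h'))]
    simp [basisPerm_of]

theorem basisPerm_mul_inversion (π : Perm (Fin n)) (i : Fin n) :
    basisPerm π * inversion i = inversion (π i) * basisPerm π := by
  refine mulAut_freeGroup_ext fun k => ?_
  simp only [MulAut.mul_apply]
  by_cases h : k = i
  · subst h
    simp [inversion_self, basisPerm_of]
  · rw [inversion_of_ne h, basisPerm_of, inversion_of_ne (fun h' => h (π.injective h'))]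

theorem basisPerm_mul_basisPerm_swap (π : Perm (Fin n)) (x y : Fin n) :
    basisPerm π * basisPerm (swap x y) = basisPerm (swap (π x) (π y)) * basisPerm π := by
  refine mulAut_freeGroup_ext fun k => ?_
  simp only [MulAut.mul_apply, basisPerm_of]
  rw [Equiv.swap_apply_apply]
  simp

/-- The partial conjugations by `a_j` of the subgroup generated by the preceding basis elements. -/
def initialConj (j : Fin n) : MulAut (FreeGroup (Fin n)) :=
  transvection j (fun i => if i < j then 1 else 0) (fun i => if i < j then 1 else 0)

theorem initialConj_of_lt {i j : Fin n} (h : i < j) :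
    initialConj j (of i) = of j * of i * (of j)⁻¹ := by
  rw [initialConj, transvection_of_ne h.ne]
  simp [h]

theorem initialConj_of_le {i j : Fin n} (h : j ≤ i) : initialConj j (of i) = of i := by
  rcases h.eq_or_lt with rfl | h
  · exact transvection_self _ _ _
  · rw [initialConj, transvection_of_ne h.ne']
    simp [h.not_gt]

/-- For `j < k`, `initialConj k` conjugates all basis elements before `a_k` by `a_k`, while
`initialConj j` preserves the subgroup they generate and fixes `a_k`. -/
theorem initialConj_commute (j k : Fin n) : Commute (initialConj j) (initialConj k) := by
  wlog h : j < k generalizing j k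
  · rcases (not_lt.1 h).eq_or_lt with rfl | h
    · exact Commute.refl _
    · exact (this _ _ h).symm
  refine mulAut_freeGroup_ext fun i => ?_
  simp only [MulAut.mul_apply]
  rcases lt_or_ge i j with hij | hij
  · simp only [initialConj_of_lt (hij.trans h), initialConj_of_lt hij, map_mul, map_inv,
      initialConj_of_le h.le, initialConj_of_lt h]
    group
  · rcases lt_or_ge i k with hik | hik
    · simp only [initialConj_of_lt hik, initialConj_of_le hij, map_mul, map_inv,
        initialConj_of_le h.le]
    · simp only [initialConj_of_le hik, initialConj_of_le hij]

/-- Automorphisms that fix the basis elements outside `S` and preserve the subgroup generated by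
those in `S`. -/
def SupportedOn (S : Set (Fin n)) (φ : MulAut (FreeGroup (Fin n))) : Prop :=
  (∀ i ∉ S, φ (of i) = of i) ∧ ∀ i ∈ S, φ (of i) ∈ Subgroup.closure (of '' S)

theorem SupportedOn.apply_eq {S T : Set (Fin n)} (hST : Disjoint S T)
    {φ : MulAut (FreeGroup (Fin n))} (h : SupportedOn S φ) {w : FreeGroup (Fin n)}
    (hw : w ∈ Subgroup.closure (of '' T)) : φ w = w := by
  have : Subgroup.closure (of '' T) ≤ φ.toMonoidHom.eqLocus (MonoidHom.id _) := by
    rw [Subgroup.closure_le]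
    rintro _ ⟨i, hi, rfl⟩
    exact h.1 i fun hi' => hST.le_bot ⟨hi', hi⟩
  exact this hw

theorem SupportedOn.commute {S T : Set (Fin n)} (hST : Disjoint S T)
    {φ ψ : MulAut (FreeGroup (Fin n))} (hφ : SupportedOn S φ) (hψ : SupportedOn T ψ) :
    Commute φ ψ := by
  refine mulAut_freeGroup_ext fun i => ?_
  simp only [MulAut.mul_apply]
  by_cases hi : i ∈ S
  · rw [hψ.1 i fun h => hST.le_bot ⟨hi, h⟩, hψ.apply_eq hST.symm (hφ.2 i hi)]
  · rw [hφ.1 i hi]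
    by_cases hT : i ∈ T
    · rw [hφ.apply_eq hST (hψ.2 i hT)]
    · rw [hψ.1 i hT, hφ.1 i hi]

/-- The involution `a_x ↦ a_y⁻¹ * a_x`, `a_y ↦ a_y⁻¹`. -/
def shear (x y : Fin n) : MulAut (FreeGroup (Fin n)) :=
  inversion y * transvection y (Pi.single x 1) 0

theorem shear_left {x y : Fin n} (h : x ≠ y) : shear x y (of x) = (of y)⁻¹ * of x := by
  rw [shear, MulAut.mul_apply, transvection_of_ne h]
  simp [inversion_self, inversion_of_ne h]

theorem shear_right (x y : Fin n) : shear x y (of y) = (of y)⁻¹ := by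
  rw [shear, MulAut.mul_apply, transvection_self, inversion_self]

theorem shear_of_ne {x y i : Fin n} (hx : i ≠ x) (hy : i ≠ y) : shear x y (of i) = of i := by
  rw [shear, MulAut.mul_apply, transvection_of_ne hy]
  simp [inversion_of_ne hy, hx]

theorem shear_mul_self (x y : Fin n) : shear x y * shear x y = 1 := by
  rw [shear]
  nth_rewrite 1 [inversion_mul_transvection]
  rw [mul_assoc, ← mul_assoc (inversion y), inversion_mul_self, one_mul, transvection_mul,
    neg_add_cancel, neg_add_cancel, transvection_zero]

theorem supportedOn_inversion {x y : Fin n} : SupportedOn {x, y} (inversion y) := by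
  refine ⟨fun i hi => inversion_of_ne fun h => hi (by simp [h]), ?_⟩
  have hmem : ∀ i ∈ ({x, y} : Set (Fin n)), of i ∈ Subgroup.closure (of '' ({x, y} : Set (Fin n))) :=
    fun i hi => Subgroup.subset_closure ⟨i, hi, rfl⟩
  intro i hi
  by_cases h : i = y
  · subst h
    rw [inversion_self]
    exact inv_mem (hmem _ hi)
  · rw [inversion_of_ne h]
    exact hmem _ hi

theorem supportedOn_shear {x y : Fin n} (hxy : x ≠ y) : SupportedOn {x, y} (shear x y) := by
  refine ⟨fun i hi => shear_of_ne (fun h => hi (by simp [h])) fun h => hi (by simp [h]), ?_⟩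
  have hx : of x ∈ Subgroup.closure (of '' ({x, y} : Set (Fin n))) :=
    Subgroup.subset_closure ⟨x, by simp, rfl⟩
  have hy : of y ∈ Subgroup.closure (of '' ({x, y} : Set (Fin n))) :=
    Subgroup.subset_closure ⟨y, by simp, rfl⟩
  rintro i (rfl | rfl)
  · rw [shear_left hxy]
    exact mul_mem (inv_mem hy) hx
  · rw [shear_right]
    exact inv_mem hy

theorem supportedOn_swap (x y : Fin n) : SupportedOn {x, y} (basisPerm (swap x y)) := by
  refine ⟨fun i hi => ?_, ?_⟩
  · rw [basisPerm_of, swap_apply_of_ne_of_ne (fun h => hi (by simp [h])) fun h => hi (by simp [h])]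
  · rintro i (rfl | rfl)
    · exact Subgroup.subset_closure ⟨y, by simp, by simp [basisPerm_of]⟩
    · exact Subgroup.subset_closure ⟨x, by simp, by simp [basisPerm_of]⟩

theorem swap_mul_inversion_pow {x y : Fin n} (hxy : x ≠ y) :
    (basisPerm (swap x y) * inversion y) ^ 4 = 1 := by
  refine mulAut_freeGroup_ext fun i => ?_
  simp only [pow_succ, pow_zero, one_mul, MulAut.mul_apply, MulAut.one_apply]
  by_cases hx : i = x
  · subst hx
    simp [inversion_of_ne hxy, inversion_self, basisPerm_of]
  · by_cases hy : i = y
    · subst hy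
      simp [inversion_of_ne hxy, inversion_self, basisPerm_of]
    · simp [inversion_of_ne hy, basisPerm_of, swap_apply_of_ne_of_ne hx hy]

theorem swap_mul_shear_pow {x y : Fin n} (hxy : x ≠ y) :
    (basisPerm (swap x y) * shear x y) ^ 3 = 1 := by
  refine mulAut_freeGroup_ext fun i => ?_
  simp only [pow_succ, pow_zero, one_mul, MulAut.mul_apply, MulAut.one_apply]
  by_cases hx : i = x
  · subst hx
    simp [shear_left hxy, shear_right, basisPerm_of]
  · by_cases hy : i = y
    · subst hy
      simp [shear_left hxy, shear_right, basisPerm_of]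
    · simp [shear_of_ne hx hy, basisPerm_of, swap_apply_of_ne_of_ne hx hy]

theorem basisPerm_mul_shear (π : Perm (Fin n)) (x y : Fin n) :
    basisPerm π * shear x y = shear (π x) (π y) * basisPerm π := by
  rw [shear, ← mul_assoc, basisPerm_mul_inversion, mul_assoc, basisPerm_mul_transvection,
    ← mul_assoc, shear]
  congr 3
  ext i
  simp [Pi.single_apply, Equiv.symm_apply_eq]

end Automorphisms

end

section

open Set Filter Topology

/-! ### Elliptic automorphisms -/

section Elliptic

open FreeGroup (of)
open Equiv

theorem exists_fixed_of_conj {X G : Type*} [Group G] [MulAction G X] {h a b : G}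
    (hab : h * a = b * h) (ha : ∃ x : X, a • x = x) : ∃ x : X, b • x = x := by
  obtain ⟨x, hx⟩ := ha
  exact ⟨h • x, by rw [smul_smul, ← hab, mul_smul, hx]⟩

theorem exists_perm_map_pair {α : Type*} [DecidableEq α] {x y x' y' : α} (h : x ≠ y)
    (h' : x' ≠ y') : ∃ π : Perm α, π x = x' ∧ π y = y' := by
  have h1 : swap x x' y ≠ x' := fun e => h (by
    exact ((swap x x').injective (e.trans (swap_apply_left x x').symm)).symm)
  refine ⟨(swap x x').trans (swap (swap x x' y) y'), ?_, ?_⟩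
  · rw [trans_apply, swap_apply_left, swap_apply_of_ne_of_ne h1.symm h']
  · rw [trans_apply, swap_apply_left]

/-- Basis permutations act transitively on ordered pairs of distinct indices, so the bootstrap need
only succeed for one pair. -/
theorem exists_fixed_transvection_single {X : Type*} {n : ℕ}
    [MulAction (MulAut (FreeGroup (Fin n))) X] (s t : ℤ) {i j i' j' : Fin n}
    (h : i ≠ j) (h' : i' ≠ j')
    (hx : ∃ x : X, transvection j (Pi.single i s) (Pi.single i t) • x = x) :
    ∃ x : X, transvection j' (Pi.single i' s) (Pi.single i' t) • x = x := by
  obtain ⟨π, rfl, rfl⟩ := exists_perm_map_pair h h'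
  refine exists_fixed_of_conj (h := basisPerm π) ?_ hx
  rw [basisPerm_mul_transvection]
  congr 2 <;>
  · ext k
    simp [Pi.single_apply, Equiv.symm_apply_eq]

variable {X : Type*} [MetricSpace X] [CompleteSpace X]

section

variable {n : ℕ} [MulAction (MulAut (FreeGroup (Fin n))) X]
  [IsIsometricSMul (MulAut (FreeGroup (Fin n))) X]

/-- The exponents of the elliptic partial conjugations by powers of a basis element. -/
def ellipticExponents [Nonempty X] (hX : IsCAT0 X) (j : Fin n) : AddSubgroup (Fin n → ℤ) where
  carrier := {p | ∃ x : X, transvection j p p • x = x}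
  zero_mem' := ⟨Classical.arbitrary X, by rw [transvection_zero, one_smul]⟩
  add_mem' := by
    intro p q hp hq
    rw [mem_ofPred_eq, ← transvection_mul]
    exact hX.exists_fixed_mul (transvection_commute j p p q q) hp hq
  neg_mem' := by
    intro p hp
    exact exists_fixed_of_conj (inversion_mul_transvection j p p) hp

theorem comp_swap_mem_ellipticExponents [Nonempty X] (hX : IsCAT0 X) {j : Fin n}
    {p : Fin n → ℤ} (hp : p ∈ ellipticExponents (X := X) hX j) {a b : Fin n} (ha : a ≠ j)
    (hb : b ≠ j) : p ∘ swap a b ∈ ellipticExponents (X := X) hX j := by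
  have h := basisPerm_mul_transvection (swap a b) j p p
  rw [swap_apply_of_ne_of_ne ha.symm hb.symm, Equiv.symm_swap] at h
  exact exists_fixed_of_conj h hp

/-- If conjugating a proper nonempty set of basis elements by `a_j` is elliptic, then so is
conjugating a single one of them. -/
theorem single_mem_ellipticExponents [Nonempty X] (hX : IsCAT0 X) {j a b : Fin n} {A : Finset (Fin n)}
    (hA : ∑ k ∈ A, Pi.single k 1 ∈ ellipticExponents (X := X) hX j) (ha : a ∈ A) (hb : b ∉ A)
    (hjA : j ∉ A) (hjb : b ≠ j) : Pi.single a 1 ∈ ellipticExponents (X := X) hX j := by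
  have haj : a ≠ j := by rintro rfl; exact hjA ha
  have hab : a ≠ b := by rintro rfl; exact hb ha
  -- Difference of the indicator of `A` and its image under exchanging `a` and `b`.
  have h1 : (Pi.single a 1 - Pi.single b 1 : Fin n → ℤ) ∈ ellipticExponents (X := X) hX j := by
    have := sub_mem hA (comp_swap_mem_ellipticExponents hX hA haj hjb)
    convert this using 1
    ext k
    simp only [Pi.sub_apply, Finset.sum_apply, Function.comp_apply, Pi.single_apply,
      Finset.sum_ite_eq]
    by_cases hka : k = a
    · subst hka
      simp [ha, hb, hab]
    · by_cases hkb : k = b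
      · subst hkb
        simp [ha, hb, hka]
      · simp [hka, hkb, swap_apply_of_ne_of_ne]
  have h2 : ∀ k ∈ A, (Pi.single a 1 - Pi.single k 1 : Fin n → ℤ) ∈
      ellipticExponents (X := X) hX j := by
    intro k hk
    by_cases hka : k = a
    · subst hka
      rw [sub_self]
      exact zero_mem _
    · have hkb : k ≠ b := by rintro rfl; exact hb hk
      have hkj : k ≠ j := by rintro rfl; exact hjA hk
      have := comp_swap_mem_ellipticExponents hX h1 hjb hkj
      convert this using 1
      ext i
      simp only [Pi.sub_apply, Function.comp_apply, Pi.single_apply]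
      by_cases hib : i = b
      · subst hib
        simp [hab.symm, hkb, hkb.symm, hka]
      · by_cases hik : i = k
        · subst hik
          simp [hka, hab.symm]
        · simp [swap_apply_of_ne_of_ne hib hik, hib, hik]
  -- Adding all `e_a - e_k` with `k ∈ A` to the indicator of `A` gives `A.card • e_a`, so a positive
  -- power of the single conjugation is elliptic.
  have h3 := add_mem hA (sum_mem h2)
  rw [← Finset.sum_add_distrib] at h3
  simp only [add_sub_cancel, Finset.sum_const] at h3
  have hpow : ∀ k : ℕ, transvection j (k • Pi.single a 1) (k • Pi.single a 1) =
      transvection j (Pi.single a 1) (Pi.single a 1) ^ k := by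
    intro k
    induction k with
    | zero => rw [zero_smul, pow_zero, transvection_zero]
    | succ k ih => rw [succ_nsmul, pow_succ, ← ih, transvection_mul]
  have h4 : ∃ x : X, transvection j (A.card • Pi.single a 1) (A.card • Pi.single a 1) • x = x := h3
  rw [hpow] at h4
  exact hX.exists_fixed_of_pow (Finset.card_pos.2 ⟨a, ha⟩) h4

end

variable {m d : ℕ} [MulAction (MulAut (FreeGroup (Fin (m + 2)))) X]
  [IsIsometricSMul (MulAut (FreeGroup (Fin (m + 2)))) X] [Nonempty X]

/-- The automorphism `w i : a_i ↦ a_l * a_i * a_l` is inverted by the inversion of `a_i`, hence is a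
product of two involutions. These `m` pairs commute for different `i`, so the bootstrap makes some
`w k` elliptic. -/
theorem exists_fixed_two_sided (hX : IsCAT0 X) (hd : CoveringDimLE X d) (hdm : d < m)
    {i j : Fin (m + 2)} (hij : i ≠ j) :
    ∃ x : X, transvection j (Pi.single i 1) (Pi.single i (-1)) • x = x := by
  set l := Fin.last (m + 1) with hl
  set e : Fin m → Fin (m + 2) := fun i => i.castSucc.castSucc with he
  have hel : ∀ i, e i ≠ l := fun i => (Fin.castSucc_lt_last _).ne
  have hinj : ∀ i j, i ≠ j → e i ≠ e j := fun i j h h' =>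
    h (Fin.castSucc_injective _ (Fin.castSucc_injective _ h'))
  set w : Fin m → MulAut (FreeGroup (Fin (m + 2))) := fun i =>
    transvection l (Pi.single (e i) 1) (Pi.single (e i) (-1)) with hw
  have hiw : ∀ i j, i ≠ j → Commute (inversion (e i)) (w j) := fun i j h =>
    inversion_commute_transvection (hel i) (by simp [hinj i j h])
  obtain ⟨k, hk⟩ := hX.exists_fixed_mul_of_involutions hd hdm (fun i => inversion (e i))
    (fun i => inversion (e i) * w i) (fun i => inversion_mul_self _)
    (by
      intro i
      have : inversion (e i) * w i = (w i)⁻¹ * inversion (e i) := by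
        rw [hw]
        dsimp only
        rw [inversion_mul_transvection_of_ne (hel i), eq_comm, inv_mul_eq_iff_eq_mul, ← mul_assoc,
          transvection_mul]
        convert (one_mul _).symm
        rw [← transvection_zero l]
        congr 1 <;>
        · ext k
          by_cases h : k = e i
          · subst h; simp
          · simp [h]
      nth_rewrite 1 [this]
      rw [mul_assoc, ← mul_assoc (inversion _), inversion_mul_self, one_mul, inv_mul_cancel])
    (by
      intro i j h
      refine ⟨inversion_commute _ _, ?_, ?_, ?_⟩
      · exact (inversion_commute _ _).mul_right (hiw i j h)
      · exact (inversion_commute _ _).mul_left (hiw j i h.symm).symm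
      · exact ((inversion_commute _ _).mul_left (hiw j i h.symm).symm).mul_right
          ((hiw i j h).mul_left (transvection_commute _ _ _ _ _)))
  simp only [← mul_assoc, inversion_mul_self, one_mul] at hk
  exact exists_fixed_transvection_single 1 (-1) (hel k) hij hk

/-- Inverting `a_j` inverts `initialConj j`, which gives commuting pairs of involutions. The index
`j` is neither the first, where the conjugation is trivial, nor the last, where no basis element is
left unconjugated besides `a_j`; exactly `m` indices remain. -/
theorem exists_fixed_partial_conj (hX : IsCAT0 X) (hd : CoveringDimLE X d) (hdm : d < m)
    {i j : Fin (m + 2)} (hij : i ≠ j) :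
    ∃ x : X, transvection j (Pi.single i 1) (Pi.single i 1) • x = x := by
  set e : Fin m → Fin (m + 2) := fun i => i.succ.castSucc with he
  have hinj : ∀ i j, i ≠ j → e i ≠ e j := fun i j h h' =>
    h (Fin.succ_injective _ (Fin.castSucc_injective _ h'))
  have hiw : ∀ i j, i ≠ j → Commute (inversion (e i)) (initialConj (e j)) := fun i j h =>
    inversion_commute_transvection (hinj i j h) rfl
  obtain ⟨k, hk⟩ := hX.exists_fixed_mul_of_involutions hd hdm (fun i => inversion (e i))
    (fun i => inversion (e i) * initialConj (e i)) (fun i => inversion_mul_self _)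
    (by
      intro i
      nth_rewrite 1 [initialConj]
      rw [inversion_mul_transvection, mul_assoc, ← mul_assoc (inversion _), inversion_mul_self,
        one_mul, initialConj, transvection_mul, neg_add_cancel, transvection_zero])
    (by
      intro i j h
      refine ⟨inversion_commute _ _, ?_, ?_, ?_⟩
      · exact (inversion_commute _ _).mul_right (hiw i j h)
      · exact (inversion_commute _ _).mul_left (hiw j i h.symm).symm
      · exact ((inversion_commute _ _).mul_left (hiw j i h.symm).symm).mul_right
          ((hiw i j h).mul_left (initialConj_commute _ _)))
  simp only [← mul_assoc, inversion_mul_self, one_mul] at hk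
  have h0 : (0 : Fin (m + 2)) < e k := by
    rw [Fin.lt_def]
    simp [he]
  have hlast : e k < Fin.last (m + 1) := Fin.castSucc_lt_last _
  have hmem : ∑ i ∈ Finset.Iio (e k), Pi.single i (1 : ℤ) ∈ ellipticExponents hX (e k) := by
    convert_to (fun i : Fin (m + 2) => if i < e k then (1 : ℤ) else 0) ∈
      ellipticExponents hX (e k) using 1
    · ext i
      simp [Finset.sum_apply, Pi.single_apply]
    · exact hk
  exact exists_fixed_transvection_single 1 1 h0.ne hij
    (single_mem_ellipticExponents hX hmem (by simpa using h0) (b := Fin.last (m + 1))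
      (by simpa using hlast.le) (by simp) hlast.ne')

/-- The Nielsen automorphisms are elliptic. -/
theorem exists_fixed_nielsen (hX : IsCAT0 X) (hd : CoveringDimLE X d) (hdm : d < m)
    {i j : Fin (m + 2)} (hij : i ≠ j) : ∃ x : X, transvection j (Pi.single i 1) 0 • x = x := by
  refine hX.exists_fixed_of_pow two_pos ?_
  -- On exponents: `(1, 1) + (1, -1) = (2, 0)`.
  have h : transvection j (Pi.single i 1) 0 ^ 2 = transvection j (Pi.single i 1) (Pi.single i 1) *
      transvection j (Pi.single i 1) (Pi.single i (-1)) := by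
    rw [pow_two, transvection_mul, transvection_mul, ← Pi.single_add, ← Pi.single_add]
    simp
  rw [h]
  exact hX.exists_fixed_mul (transvection_commute _ _ _ _ _)
    (exists_fixed_partial_conj hX hd hdm hij) (exists_fixed_two_sided hX hd hdm hij)

/-- The swap, the inversion and the shear of a pair of basis elements have a common fixed point. -/
theorem exists_fixed_rank_two_generators (hX : IsCAT0 X) (hd : CoveringDimLE X d) (hdm : d < m)
    {x y : Fin (m + 2)} (hxy : x ≠ y) : ∃ p : X, basisPerm (swap x y) • p = p ∧
      inversion y • p = p ∧ shear x y • p = p := by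
  set M := (m + 2) / 2 with hM
  set a : Fin M → Fin (m + 2) := fun i => ⟨2 * i, by omega⟩ with ha
  set b : Fin M → Fin (m + 2) := fun i => ⟨2 * i + 1, by omega⟩ with hb
  have hab : ∀ i, a i ≠ b i := fun i h => by simp [ha, hb] at h
  have hdisj : ∀ i j, i ≠ j → Disjoint ({a i, b i} : Set (Fin (m + 2))) {a j, b j} := by
    intro i j hij
    have h : (i : ℕ) ≠ j := fun h => hij (Fin.ext h)
    rw [Set.disjoint_left]
    rintro k (rfl | rfl) (hk | hk) <;> simp [ha, hb] at hk <;> omega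
  have hell : ∀ g : MulAut (FreeGroup (Fin (m + 2))), ∀ k, 0 < k → g ^ k = 1 →
      ∃ p : X, g • p = p := fun g k hk hg =>
    hX.exists_fixed_of_pow hk ⟨Classical.arbitrary X, by rw [hg, one_smul]⟩
  set s : Fin M → Fin 3 → MulAut (FreeGroup (Fin (m + 2))) := fun i =>
    ![basisPerm (swap (a i) (b i)), inversion (b i), shear (a i) (b i)] with hs
  have hsupp : ∀ i t, SupportedOn {a i, b i} (s i t) := by
    intro i t
    fin_cases t
    · exact supportedOn_swap _ _
    · exact supportedOn_inversion
    · exact supportedOn_shear (hab i)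
  -- The count suffices because `2 * ((m + 2) / 2) ≥ m + 1 > d`. Of the pairs left after dropping
  -- one involution, inversion and shear have a Nielsen automorphism as product; the other two
  -- products have orders dividing `3` and `4`.
  obtain ⟨i, p, hp⟩ := hX.exists_fixed_family (k := 2) (m := M) hd (by omega) s
    (fun i j hij t t' => (hsupp i t).commute (hdisj i j hij) (hsupp j t'))
    (by
      intro i t
      fin_cases t
      · obtain ⟨p, h1, h2⟩ := hX.exists_fixed_of_involutions (inversion_mul_self (b i))
          (shear_mul_self (a i) (b i)) (by
            rw [shear, ← mul_assoc, inversion_mul_self, one_mul]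
            exact exists_fixed_nielsen hX hd hdm (hab i))
        refine ⟨p, fun t ht => ?_⟩
        fin_cases t
        · exact absurd rfl ht
        · exact h1
        · exact h2
      · obtain ⟨p, h1, h2⟩ := hX.exists_fixed_of_involutions (basisPerm_swap_mul_self (a i) (b i))
          (shear_mul_self (a i) (b i)) (hell _ 3 (by norm_num) (swap_mul_shear_pow (hab i)))
        refine ⟨p, fun t ht => ?_⟩
        fin_cases t
        · exact h1
        · exact absurd rfl ht
        · exact h2
      · obtain ⟨p, h1, h2⟩ := hX.exists_fixed_of_involutions (basisPerm_swap_mul_self (a i) (b i))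
          (inversion_mul_self (b i)) (hell _ 4 (by norm_num) (swap_mul_inversion_pow (hab i)))
        refine ⟨p, fun t ht => ?_⟩
        fin_cases t
        · exact h1
        · exact h2
        · exact absurd rfl ht)
  obtain ⟨π, rfl, rfl⟩ := exists_perm_map_pair (hab i) hxy
  have h0 : basisPerm (swap (a i) (b i)) • p = p := hp 0
  have h1 : inversion (b i) • p = p := hp 1
  have h2 : shear (a i) (b i) • p = p := hp 2
  refine ⟨basisPerm π • p, ?_, ?_, ?_⟩
  · rw [smul_smul, ← basisPerm_mul_basisPerm_swap, mul_smul, h0]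
  · rw [smul_smul, ← basisPerm_mul_inversion, mul_smul, h1]
  · rw [smul_smul, ← basisPerm_mul_shear, mul_smul, h2]

end Elliptic

end

/-! ### Cancellation in free groups -/

section Cancellation

/-- The length of the longest common prefix of two lists. -/
def overlapLength {β : Type*} [DecidableEq β] : List β → List β → ℕ
  | a :: s, b :: t => if a = b then overlapLength s t + 1 else 0
  | [], _ => 0
  | _ :: _, [] => 0

variable {β : Type*} [DecidableEq β]

theorem exists_eq_append_overlap (x y : List β) : ∃ p s t, x = p ++ s ∧ y = p ++ t ∧
    p.length = overlapLength x y ∧ ∀ a ∈ s.head?, ∀ b ∈ t.head?, a ≠ b := by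
  induction x generalizing y with
  | nil => exact ⟨[], [], y, rfl, rfl, by simp [overlapLength], by simp⟩
  | cons a x ih =>
    cases y with
    | nil => exact ⟨[], _, [], rfl, rfl, by simp [overlapLength], by simp⟩
    | cons b y =>
      by_cases h : a = b
      · subst h
        obtain ⟨p, s, t, h1, h2, h3, h4⟩ := ih y
        exact ⟨a :: p, s, t, by simp [← h1], by simp [← h2], by simp [overlapLength, h3], h4⟩
      · exact ⟨[], _, _, rfl, rfl, by simp [overlapLength, h], by simpa using h⟩

theorem le_overlapLength_iff {k : ℕ} {x y : List β} :
    k ≤ overlapLength x y ↔ k ≤ x.length ∧ k ≤ y.length ∧ x.take k = y.take k := by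
  induction x generalizing k y with
  | nil =>
    simp only [overlapLength, List.length_nil, Nat.le_zero]
    constructor
    · rintro rfl
      simp
    · exact fun h => h.1
  | cons a x ih =>
    cases y with
    | nil =>
      simp only [overlapLength, List.length_nil, Nat.le_zero]
      constructor
      · rintro rfl
        simp
      · exact fun h => h.2.1
    | cons b y =>
      cases k with
      | zero => simp
      | succ k =>
        by_cases h : a = b
        · simp [overlapLength, h, ih]
        · simp [overlapLength, h]

open FreeGroup

variable {α : Type*} [DecidableEq α]

/-- The length of the longest common prefix of two elements of a free group. -/
def overlap (x y : FreeGroup α) : ℕ := overlapLength x.toWord y.toWord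

theorem le_overlap_iff {k : ℕ} {x y : FreeGroup α} : k ≤ overlap x y ↔
    k ≤ x.norm ∧ k ≤ y.norm ∧ x.toWord.take k = y.toWord.take k :=
  le_overlapLength_iff

theorem overlap_comm (x y : FreeGroup α) : overlap x y = overlap y x := by
  apply le_antisymm
  · obtain ⟨h1, h2, h3⟩ := le_overlap_iff.1 (le_refl (overlap x y))
    exact le_overlap_iff.2 ⟨h2, h1, h3.symm⟩
  · obtain ⟨h1, h2, h3⟩ := le_overlap_iff.1 (le_refl (overlap y x))
    exact le_overlap_iff.2 ⟨h2, h1, h3.symm⟩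

theorem le_overlap_trans {k : ℕ} {x y z : FreeGroup α} (hxy : k ≤ overlap x y)
    (hyz : k ≤ overlap y z) : k ≤ overlap x z := by
  rw [le_overlap_iff] at *
  exact ⟨hxy.1, hyz.2.1, hxy.2.2.trans hyz.2.2⟩

/-- Common prefixes satisfy the ultrametric inequality. -/
theorem overlap_eq_of_lt {x y z : FreeGroup α} (h : overlap x y < overlap y z) :
    overlap x z = overlap x y := by
  apply le_antisymm
  · by_contra! hlt
    have := le_overlap_trans (k := overlap x y + 1) (x := x) (y := z) (z := y) hlt
      (by rw [overlap_comm z y]; exact h)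
    omega
  · exact le_overlap_trans le_rfl h.le

theorem isReduced_invRev {L : List (α × Bool)} (h : IsReduced L) : IsReduced (invRev L) := by
  rw [isReduced_iff_reduce_eq] at *
  rw [reduce_invRev, h]

/-- The common prefix is exactly what cancels in `x⁻¹ * y`, so `overlap` is a Gromov product in the
Cayley tree. -/
theorem norm_inv_mul_add (x y : FreeGroup α) :
    (x⁻¹ * y).norm + 2 * overlap x y = x.norm + y.norm := by
  obtain ⟨p, s, t, hx, hy, hp, hne⟩ := exists_eq_append_overlap x.toWord y.toWord
  have hs : IsReduced s := (isReduced_toWord (x := x)).infix ⟨p, [], by simp [hx]⟩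
  have ht : IsReduced t := (isReduced_toWord (x := y)).infix ⟨p, [], by simp [hy]⟩
  have hred : IsReduced (invRev s ++ t) := by
    refine List.isChain_append.2 ⟨isReduced_invRev hs, ht, ?_⟩
    intro a ha b hb hab
    cases s with
    | nil => simp [invRev] at ha
    | cons c s =>
      have hac : a = (c.1, !c.2) := by
        simp [invRev] at ha
        exact ha.symm
      have hcb : c ≠ b := hne c (by simp) b hb
      subst hac
      have h1 : c.2 ≠ b.2 := fun h => hcb (Prod.ext hab h)
      simpa [Bool.eq_not] using h1
  have hmul : x⁻¹ * y = mk (invRev s ++ t) := by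
    rw [← mk_toWord (x := x), ← mk_toWord (x := y), hx, hy, ← mul_mk, ← mul_mk, ← mul_mk, ← inv_mk]
    group
  have h1 : (x⁻¹ * y).norm = s.length + t.length := by
    rw [FreeGroup.norm, hmul, toWord_mk, hred.reduce_eq, List.length_append, invRev_length]
  have h2 : x.norm = p.length + s.length := by rw [FreeGroup.norm, hx, List.length_append]
  have h3 : y.norm = p.length + t.length := by rw [FreeGroup.norm, hy, List.length_append]
  have h4 : overlap x y = p.length := hp.symm
  omega

theorem norm_mul_add (x y : FreeGroup α) :
    (x * y).norm + 2 * overlap x⁻¹ y = x.norm + y.norm := by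
  have := norm_inv_mul_add x⁻¹ y
  rwa [inv_inv, norm_inv_eq] at this

theorem overlap_mul_right (x y : FreeGroup α) :
    overlap x (x * y) + overlap x⁻¹ y = x.norm := by
  have h1 := norm_inv_mul_add x (x * y)
  have h2 := norm_mul_add x y
  rw [inv_mul_cancel_left] at h1
  omega

/-- Write `x = c * u * c⁻¹` with `u` cyclically reduced and nontrivial; then `x * x = c * u * u *
c⁻¹` is longer than `x` by the length of `u`. -/
theorem two_mul_overlap_inv_self_lt {x : FreeGroup α} (hx : x ≠ 1) :
    2 * overlap x⁻¹ x < x.norm := by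
  have h1 := norm_mul_add x x
  suffices x.norm < (x * x).norm by omega
  have hL : IsReduced x.toWord := isReduced_toWord
  have h2 : (x * x).toWord = reduceCyclically.conjugator x.toWord ++
      (reduceCyclically x.toWord ++ reduceCyclically x.toWord) ++
      invRev (reduceCyclically.conjugator x.toWord) := by
    have := reduceCyclically.reduce_flatten_replicate_succ hL 1
    simpa [List.replicate_succ, toWord_mul] using this
  have h3 := reduceCyclically.conj_conjugator_reduceCyclically x.toWord
  have h4 : reduceCyclically x.toWord ≠ [] := by
    intro h
    rw [h, List.append_nil] at h3
    apply hx
    rw [← mk_toWord (x := x), ← h3, ← mul_mk, ← inv_mk, mul_inv_cancel]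
  have h5 := List.length_pos_iff.2 h4
  have h6 := congrArg List.length h3
  rw [FreeGroup.norm, FreeGroup.norm, h2]
  simp only [List.length_append, invRev_length] at *
  omega

/-- If one half of `y` cancels in `z * y` and the other half in `y * z`, then `y` and `z * y` are
simultaneously conjugate to shorter elements. -/
theorem exists_shorter_conj {y z : FreeGroup α} {m : ℕ} (hy : y.norm = 2 * m)
    (h1 : m ≤ overlap z⁻¹ y) (h2 : m ≤ overlap y⁻¹ z) (hz : 2 * m ≤ z.norm) :
    ∃ r : FreeGroup α, (r⁻¹ * y * r).norm ≤ y.norm ∧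
      (r⁻¹ * (z * y) * r).norm + 2 * m ≤ z.norm := by
  obtain ⟨h1a, h1b, h1c⟩ := le_overlap_iff.1 h1
  obtain ⟨h2a, h2b, h2c⟩ := le_overlap_iff.1 h2
  -- The factorizations are `y = P * Q⁻¹` and `z = Q * R * P⁻¹`; conjugation by `Q` turns `y` into
  -- `Q⁻¹ * P` and `z * y` into `R`.
  set P := y.toWord.take m with hP
  set Q := z.toWord.take m with hQ
  have hPl : P.length = m := by
    rw [hP, List.length_take]
    exact min_eq_left h1b
  have hQl : Q.length = m := by
    rw [hQ, List.length_take]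
    exact min_eq_left h2b
  have hyw : y.toWord = P ++ y.toWord.drop m := (List.take_append_drop _ _).symm
  have hy' : y = mk P * (mk Q)⁻¹ := by
    have hw : y⁻¹.toWord = Q ++ y⁻¹.toWord.drop m := by
      rw [← h2c, List.take_append_drop]
    have hinv : y.toWord = invRev (y⁻¹.toWord.drop m) ++ invRev Q := by
      rw [← invRev_append, ← hw, toWord_inv, invRev_invRev]
    have hlen : P.length = (invRev (y⁻¹.toWord.drop m)).length := by
      have : y⁻¹.toWord.length = 2 * m := by
        rw [← hy, ← norm_inv_eq]
        rfl
      rw [invRev_length, List.length_drop, this, hPl]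
      omega
    obtain ⟨e1, e2⟩ := List.append_inj (hyw.symm.trans hinv) hlen
    rw [← mk_toWord (x := y), hyw, ← mul_mk, e2, inv_mk]
  have hz' : ∃ R : List (α × Bool), R.length + 2 * m = z.norm ∧ z = mk Q * mk R * (mk P)⁻¹ := by
    have hw : z⁻¹.toWord = P ++ z⁻¹.toWord.drop m := by
      rw [← h1c, List.take_append_drop]
    have hinv : z.toWord = invRev (z⁻¹.toWord.drop m) ++ invRev P := by
      rw [← invRev_append, ← hw, toWord_inv, invRev_invRev]
    have hzl : z⁻¹.toWord.length = z.norm := by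
      rw [← norm_inv_eq]
      rfl
    set S := invRev (z⁻¹.toWord.drop m) with hS
    have hSl : S.length = z.norm - m := by
      rw [hS, invRev_length, List.length_drop, hzl]
    have hQS : Q = S.take m := by
      rw [hQ, hinv, List.take_append_of_le_length (by omega)]
    refine ⟨S.drop m, by rw [List.length_drop]; omega, ?_⟩
    rw [← mk_toWord (x := z), hinv, hQS, mul_mk, List.take_append_drop, inv_mk, mul_mk]
  obtain ⟨R, hR, hz'⟩ := hz'
  refine ⟨mk Q, ?_, ?_⟩
  · have : (mk Q)⁻¹ * y * mk Q = (mk Q)⁻¹ * mk P := by rw [hy']; group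
    rw [this, hy]
    refine (FreeGroup.norm_mul_le _ _).trans ?_
    rw [norm_inv_eq]
    have := norm_mk_le (L₁ := P)
    have := norm_mk_le (L₁ := Q)
    omega
  · have : (mk Q)⁻¹ * (z * y) * mk Q = mk R := by rw [hy', hz']; group
    rw [this]
    have := norm_mk_le (L₁ := R)
    omega

end Cancellation

/-! ### Generators of the automorphism group of the free group of rank two -/

section Nielsen

open FreeGroup

/-- The value at a letter, that is, at a basis element or its inverse. -/
def letterValue {n : ℕ} (φ : MulAut (FreeGroup (Fin n))) (a : Fin n × Bool) : FreeGroup (Fin n) :=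
  φ (mk [a])

variable {n : ℕ}

theorem letterValue_true (φ : MulAut (FreeGroup (Fin n))) (i : Fin n) :
    letterValue φ (i, true) = φ (of i) := rfl

theorem letterValue_not (φ : MulAut (FreeGroup (Fin n))) (i : Fin n) (b : Bool) :
    letterValue φ (i, !b) = (letterValue φ (i, b))⁻¹ := by
  rw [letterValue, letterValue, ← _root_.map_inv, inv_mk]
  simp [invRev]

theorem letterValue_false (φ : MulAut (FreeGroup (Fin n))) (i : Fin n) :
    letterValue φ (i, false) = (φ (of i))⁻¹ := letterValue_not φ i true

theorem letterValue_ne_one (φ : MulAut (FreeGroup (Fin n))) (a : Fin n × Bool) :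
    letterValue φ a ≠ 1 := by
  obtain ⟨i, b⟩ := a
  cases b <;> simp [letterValue_true, letterValue_false, of_ne_one]

theorem norm_letterValue (φ : MulAut (FreeGroup (Fin n))) (i : Fin n) (b : Bool) :
    (letterValue φ (i, b)).norm = (φ (of i)).norm := by
  cases b
  · rw [letterValue_false, norm_inv_eq]
  · rfl

theorem apply_mk_cons (φ : MulAut (FreeGroup (Fin n))) (a : Fin n × Bool)
    (L : List (Fin n × Bool)) : φ (mk (a :: L)) = letterValue φ a * φ (mk L) := by
  rw [letterValue, ← _root_.map_mul, mul_mk]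
  rfl

/-- No letter of a reduced word is absorbed completely when an automorphism is applied. -/
structure IsNielsenReduced (φ : MulAut (FreeGroup (Fin n))) : Prop where
  overlap_add_lt : ∀ a b c : Fin n × Bool, (a.1 = b.1 → a.2 = b.2) → (b.1 = c.1 → b.2 = c.2) →
    overlap (letterValue φ a)⁻¹ (letterValue φ b) + overlap (letterValue φ b)⁻¹ (letterValue φ c) <
      (letterValue φ b).norm
  overlap_lt_left : ∀ a b : Fin n × Bool, (a.1 = b.1 → a.2 = b.2) →
    overlap (letterValue φ a)⁻¹ (letterValue φ b) < (letterValue φ a).norm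
  overlap_lt_right : ∀ a b : Fin n × Bool, (a.1 = b.1 → a.2 = b.2) →
    overlap (letterValue φ a)⁻¹ (letterValue φ b) < (letterValue φ b).norm

/-- The induction carries the overlap along: cancellation with a preceding letter only meets the
value at `b`, since part of that value survives against the rest of the word. Each letter then
contributes at least `1` to the length. -/
theorem IsNielsenReduced.length_le_aux {φ : MulAut (FreeGroup (Fin n))} (h : IsNielsenReduced φ)
    (b : Fin n × Bool) (L : List (Fin n × Bool)) (hL : IsReduced (b :: L)) :
    L.length + 1 ≤ (φ (FreeGroup.mk (b :: L))).norm ∧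
    ∀ a : Fin n × Bool, (a.1 = b.1 → a.2 = b.2) →
      overlap (letterValue φ a)⁻¹ (φ (FreeGroup.mk (b :: L))) =
        overlap (letterValue φ a)⁻¹ (letterValue φ b) ∧
      overlap (letterValue φ a)⁻¹ (letterValue φ b) + (L.length + 1) ≤
        (φ (FreeGroup.mk (b :: L))).norm := by
  induction L generalizing b with
  | nil =>
    change _ ≤ (letterValue φ b).norm ∧ _
    refine ⟨?_, fun a hab => ⟨rfl, ?_⟩⟩
    · simp only [List.length_nil, zero_add]
      by_contra! hlt
      exact letterValue_ne_one φ b (norm_eq_zero.1 (by omega))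
    · exact h.overlap_lt_right a b hab
  | cons c L ih =>
    have hbc : b.1 = c.1 → b.2 = c.2 := (List.isChain_cons_cons.1 hL).1
    obtain ⟨-, ih⟩ := ih c (List.isChain_cons_cons.1 hL).2
    obtain ⟨ih1, ih2⟩ := ih b hbc
    rw [apply_mk_cons]
    set w := φ (FreeGroup.mk (c :: L)) with hw
    have h1 := norm_mul_add (letterValue φ b) w
    have h2 := overlap_mul_right (letterValue φ b) w
    have h3 := h.overlap_lt_left b c hbc
    rw [ih1] at h1 h2
    simp only [List.length_cons]
    refine ⟨by omega, fun a hab => ?_⟩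
    have h4 := h.overlap_add_lt a b c hab hbc
    exact ⟨overlap_eq_of_lt (by omega), by omega⟩

theorem IsNielsenReduced.norm_le {φ : MulAut (FreeGroup (Fin n))} (h : IsNielsenReduced φ)
    (w : FreeGroup (Fin n)) : w.norm ≤ (φ w).norm := by
  have hred : IsReduced w.toWord := isReduced_toWord
  rw [FreeGroup.norm]
  conv_rhs => rw [← mk_toWord (x := w)]
  cases hw : w.toWord with
  | nil => simp
  | cons b L => exact (h.length_le_aux b L (hw ▸ hred)).1

/-- A length minimality condition under conjugations and Nielsen moves. -/
def IsMinimal (φ : MulAut (FreeGroup (Fin 2))) : Prop :=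
  ∀ i j : Fin 2, i ≠ j → ∀ (p q : ℤ) (r : FreeGroup (Fin 2)),
    (φ (of i)).norm + (φ (of j)).norm ≤
      (r⁻¹ * (φ (of j) ^ p * φ (of i) * φ (of j) ^ (-q)) * r).norm + (r⁻¹ * φ (of j) * r).norm

theorem norm_conj_inv {α : Type*} [DecidableEq α] (r x : FreeGroup α) :
    (r⁻¹ * x⁻¹ * r).norm = (r⁻¹ * x * r).norm := by
  rw [← norm_inv_eq]
  congr 1
  group

/-- The signs of the letters are covered by exponents `0, ±1` on either side; if `a` is an inverse
letter, the product is inverted first. -/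
theorem IsMinimal.norm_add_le {φ : MulAut (FreeGroup (Fin 2))} (h : IsMinimal φ)
    {a b : Fin 2 × Bool} (hab : a.1 ≠ b.1) (r : FreeGroup (Fin 2)) :
    (letterValue φ a).norm + (letterValue φ b).norm ≤
      (r⁻¹ * (letterValue φ a * letterValue φ b) * r).norm + (r⁻¹ * letterValue φ b * r).norm := by
  obtain ⟨i, s⟩ := a
  obtain ⟨j, t⟩ := b
  rw [norm_letterValue, norm_letterValue]
  have hmain : ∀ t, (φ (of i)).norm + (φ (of j)).norm ≤
      (r⁻¹ * (φ (of i) * letterValue φ (j, t)) * r).norm +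
        (r⁻¹ * letterValue φ (j, t) * r).norm ∧ (φ (of i)).norm + (φ (of j)).norm ≤
      (r⁻¹ * (letterValue φ (j, t) * φ (of i)) * r).norm +
        (r⁻¹ * letterValue φ (j, t) * r).norm := by
    intro t
    cases t
    · rw [letterValue_false, norm_conj_inv]
      exact ⟨by simpa using h i j hab 0 1 r, by simpa using h i j hab (-1) 0 r⟩
    · rw [letterValue_true]
      exact ⟨by simpa using h i j hab 0 (-1) r, by simpa using h i j hab 1 0 r⟩
  cases s
  · have := (hmain (!t)).2
    rw [letterValue_not, norm_conj_inv] at this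
    rw [letterValue_false]
    rwa [← norm_conj_inv, mul_inv_rev, inv_inv] at this
  · exact (hmain t).1

theorem IsMinimal.two_mul_overlap_le {φ : MulAut (FreeGroup (Fin 2))} (h : IsMinimal φ)
    {a b : Fin 2 × Bool} (hab : a.1 ≠ b.1) :
    2 * overlap (letterValue φ a)⁻¹ (letterValue φ b) ≤ (letterValue φ a).norm ∧
    2 * overlap (letterValue φ a)⁻¹ (letterValue φ b) ≤ (letterValue φ b).norm := by
  have h0 := norm_mul_add (letterValue φ a) (letterValue φ b)
  have h1 := h.norm_add_le hab 1
  have h2 := h.norm_add_le (a := (b.1, !b.2)) (b := (a.1, !a.2)) hab.symm 1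
  simp only [inv_one, one_mul, mul_one, letterValue_not, Prod.mk.eta] at h1 h2
  rw [← mul_inv_rev, norm_inv_eq, norm_inv_eq, norm_inv_eq] at h2
  omega

theorem fin_two_eq_of_ne {i j k : Fin 2} (h1 : i ≠ j) (h2 : j ≠ k) : k = i := by
  omega

theorem IsMinimal.isNielsenReduced {φ : MulAut (FreeGroup (Fin 2))} (h : IsMinimal φ) :
    IsNielsenReduced φ := by
  have hpos : ∀ a, 0 < (letterValue φ a).norm := fun a =>
    Nat.pos_of_ne_zero fun h0 => letterValue_ne_one φ a (norm_eq_zero.1 h0)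
  have hself : ∀ a b : Fin 2 × Bool, a.1 = b.1 → (a.1 = b.1 → a.2 = b.2) →
      a = b ∧ 2 * overlap (letterValue φ a)⁻¹ (letterValue φ b) < (letterValue φ b).norm := by
    intro a b h1 h2
    obtain rfl : a = b := Prod.ext h1 (h2 h1)
    exact ⟨rfl, two_mul_overlap_inv_self_lt (letterValue_ne_one φ a)⟩
  have hle : ∀ a b : Fin 2 × Bool, (a.1 = b.1 → a.2 = b.2) →
      2 * overlap (letterValue φ a)⁻¹ (letterValue φ b) ≤ (letterValue φ a).norm ∧
      2 * overlap (letterValue φ a)⁻¹ (letterValue φ b) ≤ (letterValue φ b).norm := by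
    intro a b hab
    by_cases h1 : a.1 = b.1
    · obtain ⟨rfl, h2⟩ := hself a b h1 hab
      exact ⟨h2.le, h2.le⟩
    · exact h.two_mul_overlap_le h1
  refine ⟨fun a b c hab hbc => ?_, fun a b hab => ?_, fun a b hab => ?_⟩
  · have h1 := (hle a b hab).2
    have h2 := (hle b c hbc).1
    by_cases e1 : a.1 = b.1
    · have := (hself a b e1 hab).2
      omega
    · by_cases e2 : b.1 = c.1
      · obtain ⟨rfl, h3⟩ := hself b c e2 hbc
        omega
      -- Here exactly half of the value at `b` cancels on each side, and `a`, `c` involve the same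
      -- basis element. If they are equal, a simultaneous conjugation contradicts minimality. If
      -- they are mutually inverse, the ultrametric inequality makes half of the value at `b` cancel
      -- against itself.
      · by_contra! hge
        have e3 : c.1 = a.1 := fin_two_eq_of_ne e1 e2
        by_cases e4 : c.2 = a.2
        · obtain rfl : c = a := Prod.ext e3 e4
          obtain ⟨r, hr1, hr2⟩ := exists_shorter_conj
            (y := letterValue φ b) (z := letterValue φ c)
            (m := overlap (letterValue φ c)⁻¹ (letterValue φ b)) (by omega) le_rfl (by omega)
            (hle c b hab).1
          have h3 := h.norm_add_le e1 r
          have := hpos b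
          omega
        · have hc : letterValue φ c = (letterValue φ a)⁻¹ := by
            rw [← letterValue_not]
            exact congrArg _ (Prod.ext e3 (by simpa [Bool.eq_not] using e4))
          rw [hc] at h2 hge
          have h3 := two_mul_overlap_inv_self_lt (letterValue_ne_one φ b)
          have h4 := le_overlap_trans
            (k := min (overlap (letterValue φ b)⁻¹ (letterValue φ a)⁻¹)
              (overlap (letterValue φ a)⁻¹ (letterValue φ b)))
            (min_le_left _ _) (min_le_right _ _)
          omega
  · have := (hle a b hab).1
    have := hpos a
    omega
  · have := (hle a b hab).2
    have := hpos b
    omega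

/-- The subgroup of `Aut(F₂)` generated by three involutions. -/
def involutionSubgroup : Subgroup (MulAut (FreeGroup (Fin 2))) :=
  Subgroup.closure {basisPerm (Equiv.swap 0 1), inversion 1, shear 0 1}

theorem swap_mem_involutionSubgroup : basisPerm (Equiv.swap 0 1) ∈ involutionSubgroup :=
  Subgroup.subset_closure (by simp)

theorem inversion_mem_involutionSubgroup (i : Fin 2) : inversion i ∈ involutionSubgroup := by
  have h1 : inversion (1 : Fin 2) ∈ involutionSubgroup := Subgroup.subset_closure (by simp)
  fin_cases i
  · have h := basisPerm_mul_inversion (Equiv.swap (0 : Fin 2) 1) 1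
    rw [Equiv.swap_apply_right, ← mul_inv_eq_iff_eq_mul] at h
    change inversion 0 ∈ involutionSubgroup
    rw [← h]
    exact mul_mem (mul_mem swap_mem_involutionSubgroup h1) (inv_mem swap_mem_involutionSubgroup)
  · exact h1

/-- `inversion 1 * shear 0 1` is left multiplication of `a_0` by `a_1`; conjugating it by `inversion
0` gives the right-hand version. In rank two every transvection along `a_1` is a product of powers
of these, and the swap handles `a_0`. -/
theorem transvection_mem_involutionSubgroup (j : Fin 2) (p q : Fin 2 → ℤ) :
    transvection j p q ∈ involutionSubgroup := by
  have key : ∀ p q, transvection (1 : Fin 2) p q ∈ involutionSubgroup := by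
    intro p q
    have h1 : transvection (1 : Fin 2) (Pi.single 0 1) 0 ∈ involutionSubgroup := by
      have : transvection (1 : Fin 2) (Pi.single 0 1) 0 = inversion 1 * shear 0 1 := by
        rw [shear, ← mul_assoc, inversion_mul_self, one_mul]
      rw [this]
      exact mul_mem (inversion_mem_involutionSubgroup 1) (Subgroup.subset_closure (by simp))
    have h2 : transvection (1 : Fin 2) 0 (Pi.single 0 1) ∈ involutionSubgroup := by
      have h := inversion_mul_transvection_of_ne (i := (0 : Fin 2)) (j := 1) (by simp)
        (Pi.single 0 1) 0
      rw [← mul_inv_eq_iff_eq_mul] at h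
      have e : transvection (1 : Fin 2) 0 (Pi.single 0 1) =
          inversion 0 * transvection 1 (Pi.single 0 1) 0 * (inversion 0)⁻¹ := by
        rw [h]
        congr 1
        ext k
        fin_cases k <;> simp
      rw [e]
      exact mul_mem (mul_mem (inversion_mem_involutionSubgroup 0) h1)
        (inv_mem (inversion_mem_involutionSubgroup 0))
    let f : Multiplicative ((Fin 2 → ℤ) × (Fin 2 → ℤ)) →* MulAut (FreeGroup (Fin 2)) :=
      { toFun := fun x => transvection 1 x.toAdd.1 x.toAdd.2
        map_one' := transvection_zero 1
        map_mul' := fun x y => (transvection_mul 1 _ _ _ _).symm }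
    have h3 : transvection (1 : Fin 2) p q = f (Multiplicative.ofAdd (Pi.single 0 1, 0)) ^ p 0 *
        f (Multiplicative.ofAdd (0, Pi.single 0 1)) ^ q 0 := by
      rw [← _root_.map_zpow f, ← _root_.map_zpow f, ← _root_.map_mul f]
      refine mulAut_freeGroup_ext fun k => ?_
      change _ = transvection 1 _ _ (of k)
      fin_cases k
      · change transvection 1 p q (of 0) = transvection 1 _ _ (of 0)
        rw [transvection_of_ne (by simp), transvection_of_ne (by simp)]
        simp
      · change transvection 1 p q (of 1) = transvection 1 _ _ (of 1)
        rw [transvection_self, transvection_self]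
    rw [h3]
    exact mul_mem (zpow_mem h1 _) (zpow_mem h2 _)
  fin_cases j
  · have h := basisPerm_mul_transvection (Equiv.swap (0 : Fin 2) 1) 1 (p ∘ Equiv.swap 0 1)
      (q ∘ Equiv.swap 0 1)
    rw [Equiv.swap_apply_right, ← mul_inv_eq_iff_eq_mul] at h
    have e : transvection 0 p q ∈ involutionSubgroup := by
      convert mul_mem (mul_mem swap_mem_involutionSubgroup
        (key (p ∘ Equiv.swap 0 1) (q ∘ Equiv.swap 0 1))) (inv_mem swap_mem_involutionSubgroup)
      rw [h]
      congr 1 <;>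
      · ext k
        simp
    exact e
  · exact key p q

theorem conj_mem_involutionSubgroup (w : FreeGroup (Fin 2)) :
    MulAut.conj w ∈ involutionSubgroup := by
  have h : (Subgroup.closure (Set.range (of : Fin 2 → _))) ≤
      involutionSubgroup.comap MulAut.conj := by
    rw [Subgroup.closure_le]
    rintro _ ⟨j, rfl⟩
    have e : MulAut.conj (of j) = transvection j 1 1 := by
      refine mulAut_freeGroup_ext fun k => ?_
      by_cases hk : k = j
      · subst hk
        rw [transvection_self]
        simp
      · rw [transvection_of_ne hk]
        simp
    rw [SetLike.mem_coe, Subgroup.mem_comap, e]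
    exact transvection_mem_involutionSubgroup j 1 1
  rw [FreeGroup.closure_range_of] at h
  exact h (Subgroup.mem_top w)

theorem fin_two_add {i j : Fin 2} (h : i ≠ j) (f : Fin 2 → ℕ) : f i + f j = f 0 + f 1 := by
  fin_cases i <;> fin_cases j
  · exact absurd rfl h
  · rfl
  · exact add_comm _ _
  · exact absurd rfl h

theorem mul_conj_mul_apply {G : Type*} [Group G] (ψ : MulAut G) (r : G) (τ : MulAut G) (w : G) :
    (ψ * (MulAut.conj (ψ⁻¹ r⁻¹) * τ)) w = r⁻¹ * ψ (τ w) * r := by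
  rw [MulAut.mul_apply, MulAut.mul_apply, MulAut.conj_apply, _root_.map_mul, _root_.map_mul,
    _root_.map_inv ψ, MulAut.apply_inv_self, inv_inv]

/-- Total length is minimized over the coset of `φ`. All competitors in `IsMinimal` lie in this
coset: conjugation by `r⁻¹` after `ψ` is conjugation by `ψ⁻¹ r⁻¹` before it. -/
theorem exists_mul_isMinimal (φ : MulAut (FreeGroup (Fin 2))) :
    ∃ h ∈ involutionSubgroup, IsMinimal (φ * h) := by
  obtain ⟨_, ⟨h, hh, rfl⟩, hmin⟩ := wellFounded_lt.has_min
    ((fun h : MulAut (FreeGroup (Fin 2)) =>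
      ((φ * h) (of 0)).norm + ((φ * h) (of 1)).norm) '' (involutionSubgroup : Set _))
    ⟨_, 1, one_mem _, rfl⟩
  refine ⟨h, hh, fun i j hij p q r => ?_⟩
  set ψ := φ * h with hψ
  have hmem : h * (MulAut.conj (ψ⁻¹ r⁻¹) * transvection j (fun _ => p) fun _ => q) ∈
      involutionSubgroup :=
    mul_mem hh (mul_mem (conj_mem_involutionSubgroup _) (transvection_mem_involutionSubgroup _ _ _))
  have := not_lt.1 (hmin _ ⟨_, hmem, rfl⟩)
  dsimp only at this
  rw [← mul_assoc φ, ← hψ] at this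
  rw [← fin_two_add hij fun i => (ψ (of i)).norm,
    ← fin_two_add hij fun i => ((ψ * (MulAut.conj (ψ⁻¹ r⁻¹) *
      transvection j (fun _ => p) fun _ => q)) (of i)).norm] at this
  have hconj := mul_conj_mul_apply ψ r
  rw [hconj, hconj, transvection_self, transvection_of_ne hij, _root_.map_mul, _root_.map_mul,
    _root_.map_zpow, _root_.map_zpow] at this
  exact this

theorem exists_letter_of_norm_le_one {α : Type*} [DecidableEq α] {x : FreeGroup α} (hx : x ≠ 1)
    (h : x.norm ≤ 1) : ∃ a, x = mk [a] := by
  have h1 : x.toWord.length = 1 := by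
    have : x.norm ≠ 0 := fun h0 => hx (norm_eq_zero.1 h0)
    change x.norm = 1
    omega
  obtain ⟨a, ha⟩ := List.length_eq_one_iff.1 h1
  exact ⟨a, by rw [← ha, mk_toWord]⟩

/-- Automorphisms mapping basis elements to basis elements or their inverses. -/
theorem mem_involutionSubgroup_of_letters {ψ : MulAut (FreeGroup (Fin 2))}
    (h : ∀ i, ∃ a, ψ (of i) = mk [a]) : ψ ∈ involutionSubgroup := by
  choose a ha using h
  -- Composing with inversions removes the signs and leaves a permutation of the basis.
  have hsign : ∀ (k : Fin 2) (b : Bool), ∃ g ∈ involutionSubgroup, g (mk [(k, b)]) = of k ∧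
      ∀ l ≠ k, ∀ b', g (mk [(l, b')]) = mk [(l, b')] := by
    intro k b
    cases b
    · refine ⟨inversion k, inversion_mem_involutionSubgroup k, ?_, fun l hl b' => ?_⟩
      · have := letterValue_false (inversion k) k
        rwa [inversion_self, inv_inv] at this
      · cases b'
        · have := letterValue_false (inversion k) l
          rw [inversion_of_ne hl] at this
          exact this
        · exact inversion_of_ne hl
    · exact ⟨1, one_mem _, rfl, fun _ _ _ => rfl⟩
  have hne : (a 0).1 ≠ (a 1).1 := by
    intro h
    have h01 : ψ (of 0) = ψ (of 1) ∨ ψ (of 0) = ψ (of 1)⁻¹ := by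
      rw [_root_.map_inv, ha, ha]
      by_cases h2 : (a 0).2 = (a 1).2
      · exact Or.inl (by rw [Prod.ext h h2])
      · right
        rw [inv_mk]
        have : a 0 = ((a 1).1, !(a 1).2) := Prod.ext h (by simpa [Bool.eq_not] using h2)
        rw [this]
        simp [invRev]
    rcases h01 with h | h
    · have := of_injective (ψ.injective h)
      simp at this
    · have h2 := ψ.injective h
      have := congrArg toWord h2
      simp [toWord_inv, invRev] at this
  obtain ⟨g₀, hg₀, h0, h0'⟩ := hsign (a 0).1 (a 0).2
  obtain ⟨g₁, hg₁, h1, h1'⟩ := hsign (a 1).1 (a 1).2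
  have e0 : (g₁ * (g₀ * ψ)) (of 0) = of (a 0).1 := by
    rw [MulAut.mul_apply, MulAut.mul_apply, ha, h0]
    exact h1' _ hne true
  have e1 : (g₁ * (g₀ * ψ)) (of 1) = of (a 1).1 := by
    rw [MulAut.mul_apply, MulAut.mul_apply, ha, h0' _ hne.symm, h1]
  have hmem : g₁ * (g₀ * ψ) ∈ involutionSubgroup := by
    have hcases : (a 0).1 = 0 ∧ (a 1).1 = 1 ∨ (a 0).1 = 1 ∧ (a 1).1 = 0 := by omega
    rcases hcases with ⟨c0, c1⟩ | ⟨c0, c1⟩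
    · rw [c0] at e0
      rw [c1] at e1
      have : g₁ * (g₀ * ψ) = 1 := by
        refine mulAut_freeGroup_ext fun i => ?_
        fin_cases i
        · exact e0
        · exact e1
      rw [this]
      exact one_mem _
    · rw [c0] at e0
      rw [c1] at e1
      have : g₁ * (g₀ * ψ) = basisPerm (Equiv.swap 0 1) := by
        refine mulAut_freeGroup_ext fun i => ?_
        rw [basisPerm_of]
        fin_cases i
        · exact e0
        · exact e1
      rw [this]
      exact swap_mem_involutionSubgroup
  exact (Subgroup.mul_mem_cancel_left _ hg₀).1 ((Subgroup.mul_mem_cancel_left _ hg₁).1 hmem)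

/-- **Nielsen's theorem** in rank two: `Aut(F₂)` is generated by three involutions. -/
theorem involutionSubgroup_eq_top : involutionSubgroup = ⊤ := by
  refine (Subgroup.eq_top_iff' _).2 fun φ => ?_
  obtain ⟨h, hh, hmin⟩ := exists_mul_isMinimal φ
  have hred := hmin.isNielsenReduced
  -- As `φ * h` does not shorten words, the preimages of basis elements have length at most one.
  have hinv : (φ * h)⁻¹ ∈ involutionSubgroup := by
    refine mem_involutionSubgroup_of_letters fun i => exists_letter_of_norm_le_one ?_ ?_
    · intro h0
      exact of_ne_one i ((MulEquiv.map_eq_one_iff _).1 h0)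
    · have := hred.norm_le ((φ * h)⁻¹ (of i))
      rwa [MulAut.apply_inv_self, norm_of] at this
  exact (Subgroup.mul_mem_cancel_right _ hh).1 (inv_mem_iff.1 hinv)

end Nielsen

/-! ### The standard embedding on the three involutions -/

section Embedding

open FreeGroup (of)
open Equiv

variable {k n : ℕ} (hk : k ≤ n)

theorem autFreeGroupEmbed_of_lt (φ : MulAut (FreeGroup (Fin k))) {i : Fin n} (h : (i : ℕ) < k) :
    autFreeGroupEmbed hk φ (of i) = FreeGroup.map (Fin.castLE hk) (φ (of ⟨i, h⟩)) := by
  change freeGroupExtend hk φ.toMonoidHom (of i) = _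
  simp [freeGroupExtend, h]

theorem autFreeGroupEmbed_of_le (φ : MulAut (FreeGroup (Fin k))) {i : Fin n} (h : k ≤ (i : ℕ)) :
    autFreeGroupEmbed hk φ (of i) = of i := by
  change freeGroupExtend hk φ.toMonoidHom (of i) = _
  simp [freeGroupExtend, h]

/-- An extended automorphism is determined by its values on the basis. -/
theorem autFreeGroupEmbed_eq {φ : MulAut (FreeGroup (Fin k))} {ψ : MulAut (FreeGroup (Fin n))}
    (h : ∀ i, FreeGroup.map (Fin.castLE hk) (φ (of i)) = ψ (of (Fin.castLE hk i)))
    (h' : ∀ i : Fin n, (∀ j, i ≠ Fin.castLE hk j) → ψ (of i) = of i) :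
    autFreeGroupEmbed hk φ = ψ := by
  refine mulAut_freeGroup_ext fun i => ?_
  rcases lt_or_ge (i : ℕ) k with hi | hi
  · rw [autFreeGroupEmbed_of_lt hk φ hi]
    exact h ⟨i, hi⟩
  · rw [autFreeGroupEmbed_of_le hk φ hi, h' i]
    rintro j rfl
    exact absurd j.2 (not_lt.2 hi)

theorem autFreeGroupEmbed_inversion (j : Fin k) :
    autFreeGroupEmbed hk (inversion j) = inversion (Fin.castLE hk j) := by
  refine autFreeGroupEmbed_eq hk (fun i => ?_) fun i hi => inversion_of_ne (hi j)
  by_cases h : i = j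
  · subst h
    simp [inversion_self]
  · rw [inversion_of_ne h, inversion_of_ne fun h' => h (Fin.castLE_injective hk h')]
    simp

theorem autFreeGroupEmbed_swap (x y : Fin k) : autFreeGroupEmbed hk (basisPerm (swap x y)) =
    basisPerm (swap (Fin.castLE hk x) (Fin.castLE hk y)) := by
  refine autFreeGroupEmbed_eq hk (fun i => ?_) fun i hi => ?_
  · rw [basisPerm_of, basisPerm_of, FreeGroup.map.of,
      (Fin.castLE_injective hk).swap_apply]
  · rw [basisPerm_of, swap_apply_of_ne_of_ne (hi x) (hi y)]

theorem autFreeGroupEmbed_shear {x y : Fin k} (hxy : x ≠ y) : autFreeGroupEmbed hk (shear x y) =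
    shear (Fin.castLE hk x) (Fin.castLE hk y) := by
  have hxy' : Fin.castLE hk x ≠ Fin.castLE hk y := fun h => hxy (Fin.castLE_injective hk h)
  refine autFreeGroupEmbed_eq hk (fun i => ?_) fun i hi => shear_of_ne (hi x) (hi y)
  by_cases hx : i = x
  · subst hx
    simp [shear_left hxy, shear_left hxy']
  · by_cases hy : i = y
    · subst hy
      simp [shear_right]
    · rw [shear_of_ne hx hy, shear_of_ne (fun h => hx (Fin.castLE_injective hk h))
        fun h => hy (Fin.castLE_injective hk h)]
      simp

end Embedding

/-! ### Conclusion -/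

theorem exists_coveringDimLE_of_lt {X : Type*} [TopologicalSpace X] {m : ℕ}
    (h : coveringDim X < (m : ℕ∞)) : ∃ d < m, CoveringDimLE X d := by
  obtain ⟨e, ⟨d, rfl, hd⟩, hlt⟩ := sInf_lt_iff.1 h
  exact ⟨d, by exact_mod_cast hlt, hd⟩

/-- The stabilizer of the common fixed point pulls back to a subgroup of `Aut(F₂)` containing the
three generating involutions. -/
theorem exists_fixed_autFreeGroupSubgroup {X : Type*} [MetricSpace X] [CompleteSpace X]
    [Nonempty X] {m d : ℕ} [MulAction (MulAut (FreeGroup (Fin (m + 2)))) X]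
    [IsIsometricSMul (MulAut (FreeGroup (Fin (m + 2)))) X] (hX : IsCAT0 X)
    (hd : CoveringDimLE X d) (hdm : d < m) (h2 : 2 ≤ m + 2) :
    ∃ x : X, ∀ h ∈ autFreeGroupSubgroup h2, h • x = x := by
  obtain ⟨x, hs, hi, hsh⟩ := exists_fixed_rank_two_generators hX hd hdm
    (x := Fin.castLE h2 0) (y := Fin.castLE h2 1)
    (fun h => by simpa using Fin.castLE_injective h2 h)
  have hle : involutionSubgroup ≤ (MulAction.stabilizer (MulAut (FreeGroup (Fin (m + 2)))) x).comap
      (autFreeGroupEmbed h2) := by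
    rw [involutionSubgroup, Subgroup.closure_le]
    rintro _ (rfl | rfl | rfl)
    · rw [SetLike.mem_coe, Subgroup.mem_comap, autFreeGroupEmbed_swap]
      exact hs
    · rw [SetLike.mem_coe, Subgroup.mem_comap, autFreeGroupEmbed_inversion]
      exact hi
    · rw [SetLike.mem_coe, Subgroup.mem_comap, autFreeGroupEmbed_shear h2 (by simp)]
      exact hsh
  refine ⟨x, ?_⟩
  rintro _ ⟨φ, rfl⟩
  rw [involutionSubgroup_eq_top] at hle
  exact hle (Subgroup.mem_top φ)

theorem theorem1p3 (n : ℕ) (hn : 4 ≤ n) :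
    RelativeFA.{u} (MulAut (FreeGroup (Fin n)))
      (autFreeGroupSubgroup (k := 2) (le_trans (by norm_num) hn)) (n - 3) ∧
    ∀ (X : Type u) [MetricSpace X] [CompleteSpace X] [Nonempty X]
      [MulAction (MulAut (FreeGroup (Fin n))) X]
      [IsIsometricSMul (MulAut (FreeGroup (Fin n))) X],
      IsCAT0 X → coveringDim X < ((n - 2 : ℕ) : ℕ∞) →
        ∃ x : X, ∀ h ∈ autFreeGroupSubgroup (k := 2) (le_trans (by norm_num) hn), h • x = x := by
  have main : ∀ (X : Type u) [MetricSpace X] [CompleteSpace X] [Nonempty X]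
      [MulAction (MulAut (FreeGroup (Fin n))) X]
      [IsIsometricSMul (MulAut (FreeGroup (Fin n))) X],
      IsCAT0 X → coveringDim X < ((n - 2 : ℕ) : ℕ∞) →
        ∃ x : X, ∀ h ∈ autFreeGroupSubgroup (k := 2) (le_trans (by norm_num) hn), h • x = x := by
    obtain ⟨m, rfl⟩ := Nat.exists_eq_add_of_le' (show 2 ≤ n by omega)
    intro X _ _ _ _ _ hX hdim
    obtain ⟨d, hdm, hd⟩ := exists_coveringDimLE_of_lt hdim
    exact exists_fixed_autFreeGroupSubgroup hX hd (by omega) _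
  refine ⟨?_, main⟩
  intro X _ _ _ _ _ hX hdim
  refine main X hX ?_
  rw [hdim]
  exact_mod_cast (by omega : n - 3 < n - 2)
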